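/- Let $\mathcal A$ be a finite set of attributes. Each $A\in\mathcal A$ has an infinite domain $\mathcal D_A$ with a strict total order $>_A$ (the attribute preference), and $\mathcal U=\prod_{A}\mathcal D_A$ is the set of tuples. A p-expression is built from the symbols $>_A$ with the binary operators $\&$ (prioritized accumulation) and $\otimes$ (Pareto accumulation); $\mathrm{Var}(\pi)$ is the set of attributes occurring in $\pi$. It induces a relation $\succ_\pi\subseteq\mathcal U\times\mathcal U$: an atom $>_A$ induces $\{(o,o') : o.A>_A o'.A\}$; $\pi_1\mathbin{\&}\pi_2$ induces $\succ_{\pi_1}\cup(\approx_{\mathrm{Var}(\pi_1)}\cap\succ_{\pi_2})$; and $\pi_1\otimes\pi_2$ induces $(\succ_{\pi_1}\cap\approx_{\mathrm{Var}(\pi_2)})\cup(\succ_{\pi_2}\cap\approx_{\mathrm{Var}(\pi_1)})\cup(\succ_{\pi_1}\cap\succ_{\pi_2})$, where $o\approx_X o'$ means $o.A=o'.A$ for all $A\in X$. Let $\mathcal F$ be the set of full p-skyline relations, i.e. the relations induced by p-expressions in which every attribute of $\mathcal A$ occurs exactly once. For $\succ\ \in\mathcal F$, a relation $\succ_{ext}\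 \in\mathcal F$ is a p-extension of $\succ$ if $\succ\ \subsetneq\ \succ_{ext}$, and it is a minimal one if moreover no $\succ'\ \in\mathcal F$ satisfies $\succ\ \subsetneq\ \succ'\ \subsetneq\ \succ_{ext}$. Both operators are associative, so p-expressions may be written with $n$-ary operators, $n\ge 2$. A syntax tree of $\succ\ \in\mathcal F$ is an ordered rooted tree representing such an expression that induces $\succ$ and in which every attribute occurs exactly once: leaves are labelled by attributes, and every other node is labelled by $\&$ or $\otimes$ and has at least two children. It is normalized if no non-leaf node has the same label as its parent. Each of the following transformation rules picks two distinct children $C,C'$ of some $\otimes$-node of a tree (at any two positions, in either order) and replaces them by a single child $E$, which takes the position of the first of the two; the rest of the tree is unchanged. Write $\&(\dots)$ and $\otimes(\dots)$ for nodes with the listed children. * $Rule_1$: $C=\&(N_1,\dots,N_m)$ with $m\ge 2$, $C'$ arbitrary, and $E=\&\big(N_1,\ \otimes(\&(N_2,\dots,N_m),\,C')\big)$. * $Rule_2$: $C=\&(N_1,\dots,N_m)$ with $m\ge 2$, $C'$ arbitrary, and $E=\&\big(\otimes(C',\,\&(N_1,\dots,N_{m-1})),\ N_m\big)$. * $Rule_3$: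 $C,C'$ are leaves and $E=\&(C,C')$. * $Rule_4$: $C=\&(N_1,\dots,N_m)$, $C'=\&(M_1,\dots,M_n)$, $1\le s\le m-1$, $1\le t\le n-1$, and $$E=\&\big(\otimes(\&(N_1,\dots,N_s),\,\&(M_1,\dots,M_t)),\ \otimes(\&(N_{s+1},\dots,N_m),\,\&(M_{t+1},\dots,M_n))\big).$$ Single-child node elimination replaces every non-leaf node that has exactly one child by that child. **Theorem.** Let $\succ\ \in\mathcal F$, let $T$ be a normalized syntax tree of $\succ$, and let $\succ_{ext}\ \subseteq\mathcal U\times\mathcal U$. Then $\succ_{ext}$ is a minimal p-extension of $\succ$ if and only if some syntax tree of $\succ_{ext}$ is obtained from $T$ by a single application of one of $Rule_1,\dots,Rule_4$, followed by single-child node elimination if necessary. -/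

import Mathlib

namespace PSkyline

/-- The two accumulation operators: `par` is Pareto accumulation `⊗`,
`pri` is prioritized accumulation `&`. -/
inductive AccOp where
  | par
  | pri
  deriving DecidableEq

/-- p-expressions over the set of attributes `A`; `atom a` stands for the attribute preference
relation of the attribute `a`. -/
inductive PExpr (A : Type*) where
  | atom (a : A)
  | app (op : AccOp) (l r : PExpr A)

/-- Tuples agreeing on all the attributes in `X`. -/
def EquivOn {A : Type*} (D : A → Type*) (X : Set A) : Set ((∀ a, D a) × (∀ a, D a)) :=
  {p | ∀ a ∈ X, p.1 a = p.2 a}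

namespace PExpr

/-- The relevant attributes of a p-expression. -/
def vars {A : Type*} : PExpr A → Set A
  | atom a => {a}
  | app _ l r => l.vars ∪ r.vars

/-- The tuple relation induced by a p-expression; `pref a x y` means that the value `x` of the
attribute `a` is preferred to the value `y`, and `(o, o')` belongs to the induced relation when
the tuple `o` is preferred to the tuple `o'`. -/
def rel {A : Type*} {D : A → Type*} (pref : ∀ a, D a → D a → Prop) :
    PExpr A → Set ((∀ a, D a) × (∀ a, D a))
  | atom a => {p | pref a (p.1 a) (p.2 a)}
  | app .pri l r => l.rel pref ∪ (EquivOn D l.vars ∩ r.rel pref)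
  | app .par l r =>
      (l.rel pref ∩ EquivOn D r.vars) ∪ (r.rel pref ∩ EquivOn D l.vars) ∪
        (l.rel pref ∩ r.rel pref)

/-- The two operands of every accumulation in the expression have disjoint sets of relevant
attributes, that is, no attribute is used twice. -/
def NonRepeating {A : Type*} : PExpr A → Prop
  | atom _ => True
  | app _ l r => Disjoint l.vars r.vars ∧ l.NonRepeating ∧ r.NonRepeating

end PExpr

/-- The set of all full p-skyline relations for the family `pref` of attribute preferences. -/
def FullPSkyline {A : Type*} {D : A → Type*} (pref : ∀ a, D a → D a → Prop) :
    Set (Set ((∀ a, D a) × (∀ a, D a))) :=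
  {R | ∃ π : PExpr A, π.NonRepeating ∧ π.vars = Set.univ ∧ π.rel pref = R}

/-- `Rext` is a p-extension of `R`. -/
def IsPExtension {A : Type*} {D : A → Type*} (pref : ∀ a, D a → D a → Prop)
    (R Rext : Set ((∀ a, D a) × (∀ a, D a))) : Prop :=
  R ∈ FullPSkyline pref ∧ Rext ∈ FullPSkyline pref ∧ R ⊂ Rext

/-- `Rext` is a minimal p-extension of `R`. -/
def IsMinimalPExtension {A : Type*} {D : A → Type*} (pref : ∀ a, D a → D a → Prop)
    (R Rext : Set ((∀ a, D a) × (∀ a, D a))) : Prop :=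
  IsPExtension pref R Rext ∧ ¬ ∃ R' ∈ FullPSkyline pref, R ⊂ R' ∧ R' ⊂ Rext

/-- Ordered rooted trees with leaves labelled by attributes and inner nodes labelled by
accumulation operators. -/
inductive SyntaxTree (A : Type*) where
  | leaf (a : A)
  | node (op : AccOp) (children : List (SyntaxTree A))

namespace SyntaxTree

/-- `T.Represents π`: the tree `T` represents the p-expression `π`. The operators being
associative, a node with children `C₁, …, Cₖ`, `k ≥ 2`, stands for `C₁ ∘ (C₂ ∘ (⋯ ∘ Cₖ))`.
A node with fewer than two children represents nothing. -/
inductive Represents {A : Type*} : SyntaxTree A → PExpr A → Prop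
  | leaf (a : A) : Represents (.leaf a) (.atom a)
  | pair {op : AccOp} {c₁ c₂ : SyntaxTree A} {π₁ π₂ : PExpr A} :
      Represents c₁ π₁ → Represents c₂ π₂ →
      Represents (.node op [c₁, c₂]) (.app op π₁ π₂)
  | cons {op : AccOp} {c c₁ c₂ : SyntaxTree A} {cs : List (SyntaxTree A)} {π ρ : PExpr A} :
      Represents c π → Represents (.node op (c₁ :: c₂ :: cs)) ρ →
      Represents (.node op (c :: c₁ :: c₂ :: cs)) (.app op π ρ)

/-- `T` is a syntax tree of the full p-skyline relation `R`. -/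
def IsSyntaxTreeOf {A : Type*} {D : A → Type*} (pref : ∀ a, D a → D a → Prop)
    (T : SyntaxTree A) (R : Set ((∀ a, D a) × (∀ a, D a))) : Prop :=
  ∃ π : PExpr A, T.Represents π ∧ π.NonRepeating ∧ π.vars = Set.univ ∧ π.rel pref = R

/-- The operator labelling the root, if the root is not a leaf. -/
def rootOp {A : Type*} : SyntaxTree A → Option AccOp
  | leaf _ => none
  | node op _ => some op

/-- Every inner node is labelled differently from its parent. -/
inductive Normalized {A : Type*} : SyntaxTree A → Prop
  | leaf (a : A) : Normalized (.leaf a)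
  | node {op : AccOp} {cs : List (SyntaxTree A)} :
      (∀ c ∈ cs, c.rootOp ≠ some op) → (∀ c ∈ cs, Normalized c) → Normalized (.node op cs)

/-- The node with the given operator and children, contracted to its child if that is unique. -/
def contract {A : Type*} (op : AccOp) : List (SyntaxTree A) → SyntaxTree A
  | [c] => c
  | cs => .node op cs

mutual
/-- Elimination of all inner nodes that have a single child. -/
def elim {A : Type*} : SyntaxTree A → SyntaxTree A
  | leaf a => .leaf a
  | node op cs => contract op (elimList cs)

/-- Single-child node elimination in every tree of a list. -/
def elimList {A : Type*} : List (SyntaxTree A) → List (SyntaxTree A)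
  | [] => []
  | c :: cs => c.elim :: elimList cs
end

/-- `PairRule C C' E`: one of the four transformation rules replaces the two children `C`, `C'`
of a `⊗`-node by the single child `E`. -/
inductive PairRule {A : Type*} : SyntaxTree A → SyntaxTree A → SyntaxTree A → Prop
  | rule1 (N₁ : SyntaxTree A) (Ns : List (SyntaxTree A)) (C : SyntaxTree A) (hNs : Ns ≠ []) :
      PairRule (.node .pri (N₁ :: Ns)) C
        (.node .pri [N₁, .node .par [.node .pri Ns, C]])
  | rule2 (Ns : List (SyntaxTree A)) (Nm : SyntaxTree A) (C : SyntaxTree A) (hNs : Ns ≠ []) :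
      PairRule (.node .pri (Ns ++ [Nm])) C
        (.node .pri [.node .par [C, .node .pri Ns], Nm])
  | rule3 (a b : A) :
      PairRule (.leaf a) (.leaf b) (.node .pri [.leaf a, .leaf b])
  | rule4 (Ns Ns' Ms Ms' : List (SyntaxTree A))
      (hNs : Ns ≠ []) (hNs' : Ns' ≠ []) (hMs : Ms ≠ []) (hMs' : Ms' ≠ []) :
      PairRule (.node .pri (Ns ++ Ns')) (.node .pri (Ms ++ Ms'))
        (.node .pri [.node .par [.node .pri Ns, .node .pri Ms],
          .node .par [.node .pri Ns', .node .pri Ms']])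

/-- `RuleStep T T'`: the tree `T'` results from `T` by a single application of one of the four
rules, before single-child node elimination. The two children `C`, `C'` of the `⊗`-node need not
be consecutive and may stand in either order; the rest of the tree is unchanged. -/
inductive RuleStep {A : Type*} : SyntaxTree A → SyntaxTree A → Prop
  | ordered {C C' E : SyntaxTree A} (l₁ l₂ l₃ : List (SyntaxTree A)) : PairRule C C' E →
      RuleStep (.node .par (l₁ ++ C :: (l₂ ++ C' :: l₃))) (.node .par (l₁ ++ E :: (l₂ ++ l₃)))
  | swapped {C C' E : SyntaxTree A} (l₁ l₂ l₃ : List (SyntaxTree A)) : PairRule C C' E →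
      RuleStep (.node .par (l₁ ++ C' :: (l₂ ++ C :: l₃))) (.node .par (l₁ ++ E :: (l₂ ++ l₃)))
  | inside {op : AccOp} {c c' : SyntaxTree A} (l r : List (SyntaxTree A)) : RuleStep c c' →
      RuleStep (.node op (l ++ c :: r)) (.node op (l ++ c' :: r))

end SyntaxTree

end PSkyline

/-!
Every relation in question is determined by a strict order on the attributes: `a` precedes `b` if
some prioritized accumulation has `a` on its left and `b` on its right. A tuple is preferred to
another one exactly if they differ and every attribute in which it is worse is preceded by one in
which it is better (`PExpr.mem_rel_iff`), so inclusion of the induced relations is inclusion of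
the orders (`PExpr.rel_subset_rel_iff`). The orders that arise are series-parallel: every set of
at least two attributes splits into two parts that are composed in series or in parallel
(`PExpr.seriesParallel_precedes`). It remains to describe the covering relation among these orders
in terms of a normalized tree `T`.

*Every proper series-parallel extension `s` of the order of `T` contains a rule application*
(`SyntaxTree.exists_ruleStep`). If `s` has a new pair inside a child of the root, pass to this
child. Otherwise the root is a `⊗`-node, and `s` relates two of its children `C` and `C'`. Being
leaves or `&`-nodes, both are connected, so `s` splits `C ∪ C'` in series into a first part `P` and
a second part `Q`. The children of an `&`-node in a normalized tree admit no series decomposition,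
hence each of `C`, `C'` lies in `P`, or lies in `Q`, or is cut into an initial segment of its
children in `P` and a final segment in `Q`. If both are cut, the fourth rule applies; if one of
them is cut, the first or the second; if none is, the third for two leaves and the first or the
second otherwise (`SyntaxTree.exists_pairRule`).

*No series-parallel order lies strictly between the orders of `T` and of a rule application*
(`SyntaxTree.RuleStep.precedes_le`). Every rule replaces `C`, `C'` by some `&(E₁, E₂)` in which
neither `E₁` nor `E₂` can be decomposed in series (`SyntaxTree.PairRule.uncuttable`). As before, an
order in between splits `C ∪ C'` in series; by the indecomposability of `E₁` and `E₂` it does so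
into `E₁` and `E₂`, and therefore it contains all the new pairs, which go from `E₁` to `E₂`.
-/

namespace PSkyline

/-! ### The precedence order of a p-expression -/

namespace PExpr

variable {A : Type*} {D : A → Type*}

/-- `π.Precedes a b`: some prioritized accumulation of `π` has `a` in its left operand and `b` in
its right operand. For a non-repeating `π` this is a strict partial order on its attributes. -/
def Precedes : PExpr A → A → A → Prop
  | atom _, _, _ => False
  | app op l r, a, b =>
      l.Precedes a b ∨ r.Precedes a b ∨ (op = .pri ∧ a ∈ l.vars ∧ b ∈ r.vars)

theorem Precedes.mem_vars {π : PExpr A} {a b : A} (h : π.Precedes a b) :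
    a ∈ π.vars ∧ b ∈ π.vars := by
  induction π with
  | atom => exact h.elim
  | app op l r ihl ihr =>
    rcases h with h | h | ⟨-, ha, hb⟩
    · exact ⟨.inl (ihl h).1, .inl (ihl h).2⟩
    · exact ⟨.inr (ihr h).1, .inr (ihr h).2⟩
    · exact ⟨.inl ha, .inr hb⟩

theorem Precedes.asymm {π : PExpr A} (hπ : π.NonRepeating) {a b : A} (h : π.Precedes a b) :
    ¬ π.Precedes b a := by
  induction π with
  | atom => exact h.elim
  | app op l r ihl ihr =>
    obtain ⟨hd, hl, hr⟩ := hπ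
    have hd' : ∀ x, x ∈ l.vars → x ∉ r.vars := fun x hx hx' => Set.disjoint_left.1 hd hx hx'
    intro h'
    rcases h with h | h | ⟨-, ha, hb⟩ <;> rcases h' with h' | h' | ⟨-, ha', hb'⟩
    · exact ihl hl h h'
    · exact hd' _ h.mem_vars.1 h'.mem_vars.2
    · exact hd' _ h.mem_vars.1 hb'
    · exact hd' _ h'.mem_vars.1 h.mem_vars.2
    · exact ihr hr h h'
    · exact hd' _ ha' h.mem_vars.2
    · exact hd' _ h'.mem_vars.1 hb
    · exact hd' _ ha h'.mem_vars.2
    · exact hd' _ ha hb'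

/-- A tuple `p.1` is preferred to `p.2` if and only if they differ and every attribute in which
`p.2` is better is preceded by one in which `p.1` is better. -/
theorem mem_rel_iff (pref : ∀ a, D a → D a → Prop) [∀ a, IsStrictTotalOrder (D a) (pref a)]
    {π : PExpr A} (hπ : π.NonRepeating) (p : (∀ a, D a) × (∀ a, D a)) :
    p ∈ π.rel pref ↔ p ∉ EquivOn D π.vars ∧ ∀ b ∈ π.vars, pref b (p.2 b) (p.1 b) →
      ∃ a, π.Precedes a b ∧ pref a (p.1 a) (p.2 a) := by
  have irr : ∀ a x, ¬ pref a x x := fun a x => irrefl_of (pref a) x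
  induction π with
  | atom a =>
    have h1 : ∀ x y, pref a x y → x ≠ y := fun x y h h' => irr a x (h' ▸ h)
    have h2 : ∀ x y, pref a x y → ¬ pref a y x := fun x y h h' => asymm_of (pref a) h h'
    have h3 := trichotomous_of (pref a) (p.1 a) (p.2 a)
    simp only [rel, EquivOn, vars, Precedes, Set.mem_ofPred_eq, Set.mem_singleton_iff,
      forall_eq, false_and, exists_false]
    grind
  | app op l r ihl ihr =>
    obtain ⟨hd, hl, hr⟩ := hπ
    have hd' : ∀ x, x ∈ l.vars → x ∉ r.vars := fun x hx hx' => Set.disjoint_left.1 hd hx hx'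
    specialize ihl hl
    specialize ihr hr
    have hE : p ∈ EquivOn D (l.vars ∪ r.vars) ↔ p ∈ EquivOn D l.vars ∧ p ∈ EquivOn D r.vars := by
      simp only [EquivOn, Set.mem_ofPred_eq, Set.mem_union]
      grind
    have hW : ∀ {X}, p ∈ EquivOn D X → ∀ b ∈ X, ¬ pref b (p.2 b) (p.1 b) ∧
        ¬ pref b (p.1 b) (p.2 b) := by
      intro X hX b hb
      rw [hX b hb]
      exact ⟨irr _ _, irr _ _⟩
    have hml : ∀ a b, l.Precedes a b → a ∈ l.vars ∧ b ∈ l.vars := fun a b h => h.mem_vars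
    have hmr : ∀ a b, r.Precedes a b → a ∈ r.vars ∧ b ∈ r.vars := fun a b h => h.mem_vars
    cases op with
    | pri =>
      -- A preferred tuple of the left operand is better in some attribute, and that attribute
      -- precedes all attributes of the right operand.
      have hgood : p ∈ l.rel pref → ∃ a ∈ l.vars, pref a (p.1 a) (p.2 a) := by
        intro h
        obtain ⟨h1, h2⟩ := ihl.1 h
        simp only [EquivOn, Set.mem_ofPred_eq, not_forall] at h1
        obtain ⟨a, ha, hne⟩ := h1
        rcases trichotomous_of (pref a) (p.1 a) (p.2 a) with h | h | h
        · exact ⟨a, ha, h⟩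
        · exact absurd h hne
        · obtain ⟨c, hc, hc'⟩ := h2 a ha h
          exact ⟨c, (hml _ _ hc).1, hc'⟩
      simp only [rel, vars, Precedes, Set.mem_union, Set.mem_inter_iff, hE, true_and]
      constructor
      · rintro (h | ⟨h, h'⟩)
        · refine ⟨fun h' => (ihl.1 h).1 h'.1, fun b hb hbad => ?_⟩
          rcases hb with hb | hb
          · obtain ⟨c, hc, hc'⟩ := (ihl.1 h).2 b hb hbad
            exact ⟨c, .inl hc, hc'⟩
          · obtain ⟨c, hc, hc'⟩ := hgood h
            exact ⟨c, .inr (.inr ⟨hc, hb⟩), hc'⟩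
        · refine ⟨fun h'' => (ihr.1 h').1 h''.2, fun b hb hbad => ?_⟩
          rcases hb with hb | hb
          · exact absurd hbad (hW h b hb).1
          · obtain ⟨c, hc, hc'⟩ := (ihr.1 h').2 b hb hbad
            exact ⟨c, .inr (.inl hc), hc'⟩
      · rintro ⟨h1, h2⟩
        by_cases hEl : p ∈ EquivOn D l.vars
        · refine .inr ⟨hEl, ihr.2 ⟨fun h => h1 ⟨hEl, h⟩, fun b hb hbad => ?_⟩⟩
          obtain ⟨c, hc | hc | hc, hc'⟩ := h2 b (.inr hb) hbad
          · exact absurd hc' (hW hEl c (hml _ _ hc).1).2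
          · exact ⟨c, hc, hc'⟩
          · exact absurd hc' (hW hEl c hc.1).2
        · refine .inl (ihl.2 ⟨hEl, fun b hb hbad => ?_⟩)
          obtain ⟨c, hc | hc | hc, hc'⟩ := h2 b (.inl hb) hbad
          · exact ⟨c, hc, hc'⟩
          · exact absurd (hmr _ _ hc).2 (hd' b hb)
          · exact absurd hc.2 (hd' b hb)
    | par =>
      simp only [rel, vars, Precedes, Set.mem_union, Set.mem_inter_iff, hE, reduceCtorEq, false_and,
        or_false]
      constructor
      · intro h
        refine ⟨by tauto, fun b hb hbad => ?_⟩
        rcases hb with hb | hb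
        · have : p ∈ l.rel pref := by
            rcases h with (h | h) | h
            · exact h.1
            · exact absurd hbad (hW h.2 b hb).1
            · exact h.1
          obtain ⟨c, hc, hc'⟩ := (ihl.1 this).2 b hb hbad
          exact ⟨c, .inl hc, hc'⟩
        · have : p ∈ r.rel pref := by
            rcases h with (h | h) | h
            · exact absurd hbad (hW h.2 b hb).1
            · exact h.1
            · exact h.2
          obtain ⟨c, hc, hc'⟩ := (ihr.1 this).2 b hb hbad
          exact ⟨c, .inr hc, hc'⟩
      · rintro ⟨h1, h2⟩
        have hWl : ∀ b ∈ l.vars, pref b (p.2 b) (p.1 b) →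
            ∃ a, l.Precedes a b ∧ pref a (p.1 a) (p.2 a) := by
          intro b hb hbad
          obtain ⟨c, hc | hc, hc'⟩ := h2 b (.inl hb) hbad
          · exact ⟨c, hc, hc'⟩
          · exact absurd (hmr _ _ hc).2 (hd' b hb)
        have hWr : ∀ b ∈ r.vars, pref b (p.2 b) (p.1 b) →
            ∃ a, r.Precedes a b ∧ pref a (p.1 a) (p.2 a) := by
          intro b hb hbad
          obtain ⟨c, hc | hc, hc'⟩ := h2 b (.inr hb) hbad
          · exact absurd hb (hd' b (hml _ _ hc).2)
          · exact ⟨c, hc, hc'⟩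
        have hL := fun h => ihl.2 ⟨h, hWl⟩
        have hR := fun h => ihr.2 ⟨h, hWr⟩
        tauto

/-- Inclusion of the induced tuple relations is inclusion of the precedence orders. -/
theorem rel_subset_rel_iff (pref : ∀ a, D a → D a → Prop)
    [∀ a, IsStrictTotalOrder (D a) (pref a)] [∀ a, Nontrivial (D a)] {π σ : PExpr A}
    (hπ : π.NonRepeating) (hσ : σ.NonRepeating) (hπu : π.vars = Set.univ)
    (hσu : σ.vars = Set.univ) :
    π.rel pref ⊆ σ.rel pref ↔ ∀ a b, π.Precedes a b → σ.Precedes a b := by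
  classical
  constructor
  · intro h a b hab
    have hne : a ≠ b := by
      rintro rfl
      exact hab.asymm hπ hab
    have hlt : ∀ c, ∃ x : D c × D c, pref c x.1 x.2 := by
      intro c
      obtain ⟨x, y, hxy⟩ := exists_pair_ne (D c)
      rcases trichotomous_of (pref c) x y with h | h | h
      exacts [⟨(x, y), h⟩, absurd h hxy, ⟨(y, x), h⟩]
    choose x hx using hlt
    have irr : ∀ c, ¬ pref c (x c).1 (x c).1 := fun c => irrefl_of (pref c) _
    have has : ∀ c, ¬ pref c (x c).2 (x c).1 := fun c h => asymm_of (pref c) (hx c) h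
    -- The first tuple is better in `a`, the second one in `b`, and they agree elsewhere.
    let p : (∀ c, D c) × (∀ c, D c) :=
      (fun c => if c = b then (x c).2 else (x c).1, fun c => if c = a then (x c).2 else (x c).1)
    have hbad : ∀ c, pref c (p.2 c) (p.1 c) → c = b := by
      intro c hc
      by_contra hcb
      simp only [p, hcb, if_false] at hc
      split_ifs at hc
      exacts [has c hc, irr c hc]
    have hgood : ∀ c, pref c (p.1 c) (p.2 c) → c = a := by
      intro c hc
      by_contra hca
      simp only [p, hca, if_false] at hc
      split_ifs at hc
      exacts [has c hc, irr c hc]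
    have ha : pref a (p.1 a) (p.2 a) := by simpa [p, hne] using hx a
    have hb : pref b (p.2 b) (p.1 b) := by simpa [p, hne.symm] using hx b
    have hp : p ∈ π.rel pref := by
      rw [mem_rel_iff pref hπ]
      refine ⟨fun hE => irrefl_of (pref a) (p.2 a) ?_, fun c _ hc => ?_⟩
      · have := hE a (hπu ▸ Set.mem_univ a)
        rwa [this] at ha
      · rw [hbad c hc]
        exact ⟨a, hab, ha⟩
    obtain ⟨c, hc, hc'⟩ := ((mem_rel_iff pref hσ p).1 (h hp)).2 b (hσu ▸ Set.mem_univ b) hb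
    rwa [hgood c hc'] at hc
  · intro h p hp
    rw [mem_rel_iff pref hπ, hπu] at hp
    rw [mem_rel_iff pref hσ, hσu]
    refine ⟨hp.1, fun b hb hbad => ?_⟩
    obtain ⟨a, ha, ha'⟩ := hp.2 b hb hbad
    exact ⟨a, h a b ha, ha'⟩

end PExpr

/-! ### Series-parallel orders -/

section SeriesParallel

variable {A : Type*}

/-- A series-parallel order, given by its decomposition property: every set with at least two
elements splits into two nonempty parts that are either completely ordered one before the other
or completely incomparable. Transitivity follows by splitting sets of three elements. -/
structure SeriesParallel (s : A → A → Prop) : Prop where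
  asymm : ∀ a b, s a b → ¬ s b a
  split : ∀ S : Set A, S.Nontrivial → ∃ P Q : Set A, P.Nonempty ∧ Q.Nonempty ∧ Disjoint P Q ∧
    P ∪ Q = S ∧ ((∀ p ∈ P, ∀ q ∈ Q, s p q) ∨ (∀ p ∈ P, ∀ q ∈ Q, ¬ s p q ∧ ¬ s q p))

theorem PExpr.seriesParallel_precedes {π : PExpr A} (hπ : π.NonRepeating)
    (hu : π.vars = Set.univ) : SeriesParallel π.Precedes := by
  refine ⟨fun a b h => h.asymm hπ, fun S hS => ?_⟩
  have hSu : S ⊆ π.vars := hu ▸ Set.subset_univ S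
  clear hu
  induction π with
  | atom a =>
    exact absurd hS (Set.not_nontrivial_iff.2 (Set.subsingleton_singleton.anti hSu))
  | app op l r ihl ihr =>
    obtain ⟨hd, hl, hr⟩ := hπ
    have hd' : ∀ x, x ∈ l.vars → x ∉ r.vars := fun x hx hx' => Set.disjoint_left.1 hd hx hx'
    have hml : ∀ {a b}, l.Precedes a b → a ∈ l.vars ∧ b ∈ l.vars := fun h => h.mem_vars
    have hmr : ∀ {a b}, r.Precedes a b → a ∈ r.vars ∧ b ∈ r.vars := fun h => h.mem_vars
    by_cases hSl : S ⊆ l.vars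
    · obtain ⟨P, Q, hP, hQ, hPQ, rfl, h⟩ := ihl hl hSl
      refine ⟨P, Q, hP, hQ, hPQ, rfl, h.imp (fun h p hp q hq => .inl (h p hp q hq)) ?_⟩
      intro h p hp q hq
      have := h p hp q hq
      have h1 := hd' p (hSl (.inl hp))
      have h2 := hd' q (hSl (.inr hq))
      simp only [Precedes, h1, h2, and_false, or_false, this, false_or]
      exact ⟨fun h => h1 (hmr h).1, fun h => h2 (hmr h).1⟩
    by_cases hSr : S ⊆ r.vars
    · obtain ⟨P, Q, hP, hQ, hPQ, rfl, h⟩ := ihr hr hSr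
      refine ⟨P, Q, hP, hQ, hPQ, rfl, h.imp (fun h p hp q hq => .inr (.inl (h p hp q hq))) ?_⟩
      intro h p hp q hq
      have := h p hp q hq
      have h1 : p ∉ l.vars := fun hp' => hd' p hp' (hSr (.inl hp))
      have h2 : q ∉ l.vars := fun hp' => hd' q hp' (hSr (.inr hq))
      simp only [Precedes, h1, h2, and_false, or_false, this, false_and]
      exact ⟨fun h => h1 (hml h).1, fun h => h2 (hml h).1⟩
    · rw [Set.not_subset] at hSl hSr
      obtain ⟨x, hx, hxl⟩ := hSl
      obtain ⟨y, hy, hyr⟩ := hSr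
      refine ⟨S ∩ l.vars, S ∩ r.vars, ⟨y, hy, (hSu hy).resolve_right hyr⟩,
        ⟨x, hx, (hSu hx).resolve_left hxl⟩, hd.mono Set.inter_subset_right Set.inter_subset_right,
        ?_, ?_⟩
      · rw [← Set.inter_union_distrib_left]
        exact Set.inter_eq_left.2 hSu
      · cases op with
        | pri => exact .inl fun p hp q hq => .inr (.inr ⟨rfl, hp.2, hq.2⟩)
        | par =>
          refine .inr fun p hp q hq => ⟨?_, ?_⟩ <;> rintro (h | h | h)
          · exact hd' q (hml h).2 hq.2
          · exact hd' p hp.2 (hmr h).1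
          · exact absurd h.1 (by simp)
          · exact hd' q (hml h).1 hq.2
          · exact hd' p hp.2 (hmr h).2
          · exact absurd h.1 (by simp)

/-- `X` cannot be cut into two nonempty parts such that all elements of the first part stand in
the relation `t` to all elements of the second one. -/
def Uncuttable (t : A → A → Prop) (X : Set A) : Prop :=
  ∀ P Q : Set A, X ⊆ P ∪ Q → (∀ p ∈ P, ∀ q ∈ Q, t p q) → X ⊆ P ∨ X ⊆ Q

theorem Uncuttable.singleton (t : A → A → Prop) (a : A) : Uncuttable t {a} := by
  intro P Q h _
  simpa using h

/-- A set with two nonempty parts whose elements are never related is uncuttable: an element of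
either part on one side of a cut forces the whole other part, and then its own, to that side. -/
theorem Uncuttable.union {t : A → A → Prop} {U V : Set A} (hU : U.Nonempty) (hV : V.Nonempty)
    (h : ∀ u ∈ U, ∀ v ∈ V, ¬ t u v ∧ ¬ t v u) : Uncuttable t (U ∪ V) := by
  intro P Q hPQ ht
  obtain ⟨u, hu⟩ := hU
  obtain ⟨v, hv⟩ := hV
  have hUV : ∀ x ∈ U, x ∈ P ∨ x ∈ Q := fun x hx => hPQ (.inl hx)
  have hVU : ∀ x ∈ V, x ∈ P ∨ x ∈ Q := fun x hx => hPQ (.inr hx)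
  rcases hUV u hu with huP | huQ
  · have hVP : ∀ y ∈ V, y ∈ P := fun y hy =>
      (hVU y hy).resolve_right fun hyQ => (h u hu y hy).1 (ht u huP y hyQ)
    refine .inl (Set.union_subset (fun x hx => (hUV x hx).resolve_right fun hxQ => ?_) hVP)
    exact (h x hx v hv).2 (ht v (hVP v hv) x hxQ)
  · have hVQ : ∀ y ∈ V, y ∈ Q := fun y hy =>
      (hVU y hy).resolve_left fun hyP => (h u hu y hy).2 (ht y hyP u huQ)
    refine .inr (Set.union_subset (fun x hx => (hUV x hx).resolve_left fun hxP => ?_) hVQ)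
    exact (h x hx v hv).1 (ht x hxP v (hVQ v hv))

theorem Uncuttable.mono {t t' : A → A → Prop} {X : Set A} (h : Uncuttable t X)
    (htt : ∀ a ∈ X, ∀ b ∈ X, t' a b → t a b) : Uncuttable t' X := by
  intro P Q hPQ ht
  refine (h (P ∩ X) (Q ∩ X) ?_ fun p hp q hq => htt p hp.2 q hq.2 (ht p hp.1 q hq.1)).imp
    (fun h => h.trans Set.inter_subset_left) fun h => h.trans Set.inter_subset_left
  intro x hx
  exact (hPQ hx).imp (⟨·, hx⟩) (⟨·, hx⟩)

/-- If two disjoint sets `X` and `Y` are each parallel-indecomposable and some element of `X` is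
comparable with some element of `Y`, then a series-parallel order decomposes `X ∪ Y` in series. -/
theorem SeriesParallel.exists_series {s : A → A → Prop} (hs : SeriesParallel s) {X Y : Set A}
    (hXY : Disjoint X Y) (hX : Uncuttable (fun a b => ¬ s a b ∧ ¬ s b a) X)
    (hY : Uncuttable (fun a b => ¬ s a b ∧ ¬ s b a) Y)
    {x y : A} (hx : x ∈ X) (hy : y ∈ Y) (hxy : s x y ∨ s y x) :
    ∃ P Q : Set A, P.Nonempty ∧ Q.Nonempty ∧ P ∪ Q = X ∪ Y ∧ ∀ p ∈ P, ∀ q ∈ Q, s p q := by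
  have hne : x ≠ y := fun h => Set.disjoint_left.1 hXY hx (h ▸ hy)
  obtain ⟨P, Q, hP, hQ, hPQ, hU, h | h⟩ := hs.split (X ∪ Y) ⟨x, .inl hx, y, .inr hy, hne⟩
  · exact ⟨P, Q, hP, hQ, hU, h⟩
  · exfalso
    have hXU : X ⊆ P ∪ Q := hU ▸ Set.subset_union_left
    have hYU : Y ⊆ P ∪ Q := hU ▸ Set.subset_union_right
    obtain ⟨p, hp⟩ := hP
    obtain ⟨q, hq⟩ := hQ
    rcases hX P Q hXU h with hXP | hXQ <;> rcases hY P Q hYU h with hYP | hYQ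
    · exact Set.disjoint_left.1 hPQ (Set.union_subset hXP hYP (hU ▸ .inr hq)) hq
    · have := h x (hXP hx) y (hYQ hy)
      tauto
    · have := h y (hYP hy) x (hXQ hx)
      tauto
    · exact Set.disjoint_left.1 hPQ hp (Set.union_subset hXQ hYQ (hU ▸ .inl hp))

end SeriesParallel

/-! ### Attributes and precedence order of a syntax tree -/

namespace SyntaxTree

variable {A : Type*}

/-- `T.Occurs a`: the attribute `a` labels a leaf of `T`. -/
inductive Occurs : SyntaxTree A → A → Prop
  | leaf (a : A) : Occurs (.leaf a) a
  | node {op : AccOp} {cs : List (SyntaxTree A)} {c : SyntaxTree A} {a : A} :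
      c ∈ cs → Occurs c a → Occurs (.node op cs) a

/-- The attributes labelling the leaves of a tree. -/
def attrs (T : SyntaxTree A) : Set A := {a | T.Occurs a}

/-- `T.Precedes a b`: at some `&`-node of `T`, the attribute `a` occurs in an earlier child than
the attribute `b`. -/
inductive Precedes : SyntaxTree A → A → A → Prop
  | inside {op : AccOp} {cs : List (SyntaxTree A)} {c : SyntaxTree A} {a b : A} :
      c ∈ cs → Precedes c a b → Precedes (.node op cs) a b
  | across {cs : List (SyntaxTree A)} {c c' : SyntaxTree A} {a b : A} :
      [c, c'].Sublist cs → a ∈ c.attrs → b ∈ c'.attrs → Precedes (.node .pri cs) a b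

theorem attrs_leaf (a : A) : attrs (.leaf a) = {a} := by
  ext b
  constructor
  · rintro ⟨⟩
    rfl
  · rintro rfl
    exact .leaf _

theorem mem_attrs_node {op : AccOp} {cs : List (SyntaxTree A)} {a : A} :
    a ∈ attrs (.node op cs) ↔ ∃ c ∈ cs, a ∈ c.attrs := by
  constructor
  · rintro ⟨⟩
    exact ⟨_, ‹_›, ‹_›⟩
  · rintro ⟨c, hc, ha⟩
    exact .node hc ha

theorem attrs_nil (op : AccOp) : attrs (.node op [] : SyntaxTree A) = ∅ := by
  ext
  simp [mem_attrs_node]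

theorem attrs_append (op : AccOp) (l r : List (SyntaxTree A)) :
    attrs (.node op (l ++ r)) = attrs (.node op l) ∪ attrs (.node op r) := by
  ext
  simp [mem_attrs_node, or_and_right, exists_or]

theorem attrs_cons (op : AccOp) (c : SyntaxTree A) (cs : List (SyntaxTree A)) :
    attrs (.node op (c :: cs)) = attrs c ∪ attrs (.node op cs) := by
  ext
  simp [mem_attrs_node]

theorem attrs_subset_node {op : AccOp} {cs : List (SyntaxTree A)} {c : SyntaxTree A}
    (hc : c ∈ cs) : attrs c ⊆ attrs (.node op cs) :=
  fun _ ha => .node hc ha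

theorem not_precedes_leaf (c a b : A) : ¬ Precedes (.leaf c) a b := by
  rintro ⟨⟩

theorem precedes_par {cs : List (SyntaxTree A)} {a b : A} :
    Precedes (.node .par cs) a b ↔ ∃ c ∈ cs, Precedes c a b := by
  constructor
  · rintro ⟨⟩
    exact ⟨_, ‹_›, ‹_›⟩
  · rintro ⟨c, hc, h⟩
    exact .inside hc h

theorem precedes_nil (op : AccOp) (a b : A) : ¬ Precedes (.node op []) a b := by
  rintro (⟨h, -⟩ | ⟨h, -, -⟩)
  · simp at h
  · simp at h

theorem precedes_append {op : AccOp} {l r : List (SyntaxTree A)} {a b : A} :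
    Precedes (.node op (l ++ r)) a b ↔ Precedes (.node op l) a b ∨ Precedes (.node op r) a b ∨
      (op = .pri ∧ a ∈ attrs (.node op l) ∧ b ∈ attrs (.node op r)) := by
  constructor
  · rintro (⟨hc, h⟩ | ⟨h, ha, hb⟩)
    · rcases List.mem_append.1 hc with hc | hc
      · exact .inl (.inside hc h)
      · exact .inr (.inl (.inside hc h))
    · obtain ⟨l₁, l₂, e, h₁, h₂⟩ := List.sublist_append_iff.1 h
      rcases l₁ with _ | ⟨x, _ | ⟨y, l₁⟩⟩
      · exact .inr (.inl (.across (by simpa [e] using h₂) ha hb))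
      · simp only [List.cons_append, List.nil_append, List.cons.injEq] at e
        obtain ⟨rfl, rfl⟩ := e
        exact .inr (.inr ⟨rfl, attrs_subset_node (List.singleton_sublist.1 h₁) ha,
          attrs_subset_node (List.singleton_sublist.1 h₂) hb⟩)
      · simp only [List.cons_append, List.cons.injEq] at e
        obtain ⟨rfl, rfl, e⟩ := e
        obtain ⟨rfl, rfl⟩ := List.append_eq_nil_iff.1 e.symm
        exact .inl (.across h₁ ha hb)
  · rintro (h | h | ⟨rfl, ha, hb⟩)
    · cases h with
      | inside hc h => exact .inside (List.mem_append_left _ hc) h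
      | across h ha hb => exact .across (h.trans (List.sublist_append_left _ _)) ha hb
    · cases h with
      | inside hc h => exact .inside (List.mem_append_right _ hc) h
      | across h ha hb => exact .across (h.trans (List.sublist_append_right _ _)) ha hb
    · obtain ⟨c, hc, ha⟩ := mem_attrs_node.1 ha
      obtain ⟨c', hc', hb⟩ := mem_attrs_node.1 hb
      exact .across ((List.singleton_sublist.2 hc).append (List.singleton_sublist.2 hc')) ha hb

theorem precedes_singleton {op : AccOp} {c : SyntaxTree A} {a b : A} :
    Precedes (.node op [c]) a b ↔ Precedes c a b := by
  constructor
  · rintro (⟨hc, h⟩ | ⟨h, -, -⟩)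
    · rwa [← List.mem_singleton.1 hc]
    · simpa using h.length_le
  · exact .inside (List.mem_singleton_self c)

theorem precedes_cons {op : AccOp} {c : SyntaxTree A} {cs : List (SyntaxTree A)} {a b : A} :
    Precedes (.node op (c :: cs)) a b ↔ Precedes c a b ∨ Precedes (.node op cs) a b ∨
      (op = .pri ∧ a ∈ attrs c ∧ b ∈ attrs (.node op cs)) := by
  have := precedes_append (op := op) (l := [c]) (r := cs) (a := a) (b := b)
  simpa only [List.singleton_append, precedes_singleton, attrs_cons, attrs_nil,
    Set.union_empty] using this

theorem Precedes.mem_attrs {T : SyntaxTree A} {a b : A} (h : T.Precedes a b) :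
    a ∈ T.attrs ∧ b ∈ T.attrs := by
  induction h with
  | inside hc _ ih => exact ⟨attrs_subset_node hc ih.1, attrs_subset_node hc ih.2⟩
  | across h ha hb =>
    exact ⟨attrs_subset_node (h.subset (by simp)) ha, attrs_subset_node (h.subset (by simp)) hb⟩

/-- No attribute occurs twice and every inner node has at least `k` children. -/
inductive Proper (k : ℕ) : SyntaxTree A → Prop
  | leaf (a : A) : Proper k (.leaf a)
  | node {op : AccOp} {cs : List (SyntaxTree A)} :
      k ≤ cs.length → (∀ c ∈ cs, Proper k c) → cs.Pairwise (fun c d => Disjoint c.attrs d.attrs) →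
      Proper k (.node op cs)

theorem proper_node {k : ℕ} {op : AccOp} {cs : List (SyntaxTree A)} :
    Proper k (.node op cs) ↔ k ≤ cs.length ∧ (∀ c ∈ cs, Proper k c) ∧
      cs.Pairwise (fun c d => Disjoint c.attrs d.attrs) :=
  ⟨by rintro ⟨⟩; exact ⟨‹_›, ‹_›, ‹_›⟩, fun h => .node h.1 h.2.1 h.2.2⟩

theorem normalized_node {op : AccOp} {cs : List (SyntaxTree A)} :
    Normalized (.node op cs) ↔
      (∀ c ∈ cs, c.rootOp ≠ some op) ∧ (∀ c ∈ cs, Normalized c) :=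
  ⟨by rintro ⟨⟩; exact ⟨‹_›, ‹_›⟩, fun h => .node h.1 h.2⟩

theorem Proper.mono {j k : ℕ} (hjk : j ≤ k) {T : SyntaxTree A} (h : T.Proper k) :
    T.Proper j := by
  induction h with
  | leaf a => exact .leaf a
  | node hl _ hp ih => exact .node (hjk.trans hl) ih hp

theorem Proper.attrs_nonempty {T : SyntaxTree A} (h : T.Proper 1) : T.attrs.Nonempty := by
  induction h with
  | leaf a => exact ⟨a, .leaf a⟩
  | node hl _ hp ih =>
    obtain ⟨c, hc⟩ := List.exists_mem_of_length_pos hl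
    exact (ih c hc).mono (attrs_subset_node hc)

theorem attrs_node_nonempty {op : AccOp} {cs : List (SyntaxTree A)} (hcs : cs ≠ [])
    (h : ∀ c ∈ cs, Proper 1 c) : (attrs (.node op cs)).Nonempty := by
  obtain ⟨c, hc⟩ := List.exists_mem_of_ne_nil cs hcs
  exact (h c hc).attrs_nonempty.mono (attrs_subset_node hc)

/-- An attribute determines the child of a node in which it occurs. -/
theorem Proper.eq_of_mem {k : ℕ} {op : AccOp} {cs : List (SyntaxTree A)}
    (h : Proper k (.node op cs)) {c c' : SyntaxTree A} (hc : c ∈ cs) (hc' : c' ∈ cs) {a : A}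
    (ha : a ∈ c.attrs) (ha' : a ∈ c'.attrs) : c = c' := by
  by_contra hne
  have : Std.Symm (fun x y : SyntaxTree A => Disjoint x.attrs y.attrs) := ⟨fun _ _ h => h.symm⟩
  exact Set.disjoint_left.1 ((proper_node.1 h).2.2.forall hc hc' hne) ha ha'

/-- On the attributes of a child, the precedence order of a node is that of the child. -/
theorem Proper.precedes_child {k : ℕ} {op : AccOp} {cs : List (SyntaxTree A)}
    (h : Proper k (.node op cs)) {c : SyntaxTree A} (hc : c ∈ cs) {a b : A}
    (ha : a ∈ c.attrs) (hb : b ∈ c.attrs) (hab : Precedes (.node op cs) a b) :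
    Precedes c a b := by
  cases hab with
  | inside hd hab => rwa [h.eq_of_mem hc hd ha hab.mem_attrs.1]
  | across hs ha' hb' =>
    rename_i c₁ c₂
    obtain rfl := h.eq_of_mem hc (hs.subset (by simp)) ha ha'
    obtain rfl := h.eq_of_mem hc (hs.subset (by simp)) hb hb'
    have := (proper_node.1 h).2.2.sublist hs
    simp only [List.pairwise_cons, List.mem_singleton, forall_eq] at this
    exact absurd ha (Set.disjoint_left.1 this.1 ha)

theorem Proper.disjoint_append {k : ℕ} {op : AccOp} {l r : List (SyntaxTree A)}
    (h : Proper k (.node op (l ++ r))) :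
    Disjoint (attrs (.node op l)) (attrs (.node op r)) := by
  rw [Set.disjoint_left]
  intro a ha ha'
  obtain ⟨c, hc, ha⟩ := mem_attrs_node.1 ha
  obtain ⟨d, hd, ha'⟩ := mem_attrs_node.1 ha'
  have := (List.pairwise_append.1 (proper_node.1 h).2.2).2.2 c hc d hd
  exact Set.disjoint_left.1 this ha ha'

theorem exists_eq_append_of_mem_of_ne {α : Type*} {l : List α} {x y : α} (hx : x ∈ l)
    (hy : y ∈ l) (hne : x ≠ y) :
    ∃ l₁ l₂ l₃, l = l₁ ++ x :: (l₂ ++ y :: l₃) ∨ l = l₁ ++ y :: (l₂ ++ x :: l₃) := by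
  obtain ⟨s, t, rfl⟩ := List.append_of_mem hx
  rcases List.mem_append.1 hy with hy | hy
  · obtain ⟨u, v, rfl⟩ := List.append_of_mem hy
    exact ⟨u, v, t, .inr (by simp)⟩
  · obtain ⟨u, v, rfl⟩ := List.append_of_mem ((List.mem_cons.1 hy).resolve_left hne.symm)
    exact ⟨s, u, v, .inl (by simp)⟩

/-- Attributes in different children of an `&`-node are comparable. -/
theorem precedes_pri_total {cs : List (SyntaxTree A)} {c c' : SyntaxTree A} (hc : c ∈ cs)
    (hc' : c' ∈ cs) (hne : c ≠ c') {a b : A} (ha : a ∈ c.attrs) (hb : b ∈ c'.attrs) :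
    Precedes (.node .pri cs) a b ∨ Precedes (.node .pri cs) b a := by
  obtain ⟨l₁, l₂, l₃, rfl | rfl⟩ := exists_eq_append_of_mem_of_ne hc hc' hne
  · exact .inl (by simp [precedes_append, precedes_cons, attrs_append, attrs_cons, ha, hb])
  · exact .inr (by simp [precedes_append, precedes_cons, attrs_append, attrs_cons, ha, hb])

/-! ### Syntax trees and p-expressions -/

theorem Represents.precedes_iff {T : SyntaxTree A} {π : PExpr A} (h : T.Represents π) :
    T.attrs = π.vars ∧ ∀ a b, T.Precedes a b ↔ π.Precedes a b := by
  induction h with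
  | leaf a => exact ⟨attrs_leaf a, fun b c => iff_of_false (not_precedes_leaf a b c) (fun h => h)⟩
  | pair _ _ ih₁ ih₂ =>
    simp [attrs_cons, attrs_nil, precedes_cons, precedes_nil, PExpr.vars, PExpr.Precedes,
      ih₁, ih₂]
  | cons _ _ ih₁ ih₂ =>
    refine ⟨by rw [attrs_cons, ih₁.1, ih₂.1, PExpr.vars], fun a b => ?_⟩
    rw [precedes_cons, ih₁.1, ih₂.1, ih₁.2, ih₂.2, PExpr.Precedes]

theorem Represents.proper {T : SyntaxTree A} {π : PExpr A} (h : T.Represents π)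
    (hπ : π.NonRepeating) : T.Proper 2 := by
  induction h with
  | leaf a => exact .leaf a
  | pair h₁ h₂ ih₁ ih₂ =>
    obtain ⟨hd, hl, hr⟩ := hπ
    rw [← h₁.precedes_iff.1, ← h₂.precedes_iff.1] at hd
    refine .node (by simp) ?_ (by simpa using hd)
    simp [ih₁ hl, ih₂ hr]
  | @cons op c c₁ c₂ cs π ρ h₁ h₂ ih₁ ih₂ =>
    obtain ⟨hd, hl, hr⟩ := hπ
    rw [← h₁.precedes_iff.1, ← h₂.precedes_iff.1] at hd
    obtain ⟨-, hp, hdisj⟩ := proper_node.1 (ih₂ hr)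
    refine .node (by simp) (List.forall_mem_cons.2 ⟨ih₁ hl, hp⟩) (List.pairwise_cons.2 ⟨?_, hdisj⟩)
    exact fun d hd' => hd.mono_right (attrs_subset_node hd')

/-- Single-child node elimination turns a tree without repeated attributes and without childless
inner nodes into a tree of a p-expression, and preserves attributes and order. -/
theorem Proper.exists_elim_represents {T : SyntaxTree A} (hT : T.Proper 1) :
    ∃ π, T.elim.Represents π ∧ π.NonRepeating ∧ T.attrs = π.vars ∧
      ∀ a b, T.Precedes a b ↔ π.Precedes a b := by
  induction hT with
  | leaf a =>
    refine ⟨.atom a, ?_, trivial, attrs_leaf a,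
      fun b c => iff_of_false (not_precedes_leaf a b c) (fun h => h)⟩
    rw [elim]
    exact .leaf a
  | @node op cs hl _ hdisj ih =>
    rw [elim]
    induction cs with
    | nil => simp at hl
    | cons c cs ihcs =>
      obtain ⟨π, hc, hπ, hv, hp⟩ := ih c (by simp)
      rcases cs with _ | ⟨d, ds⟩
      · refine ⟨π, by simpa [elimList, contract] using hc, hπ, ?_, ?_⟩
        · simp [attrs_cons, attrs_nil, hv]
        · simp [precedes_singleton, hp]
      · rename_i hprop
        obtain ⟨hd, hdisj⟩ := List.pairwise_cons.1 hdisj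
        obtain ⟨ρ, hρ, hρn, hρv, hρp⟩ := ihcs (by simp) (fun x hx => hprop x (by simp [hx])) hdisj
          (fun x hx => ih x (by simp [hx]))
        refine ⟨.app op π ρ, ?_, ⟨?_, hπ, hρn⟩, ?_, ?_⟩
        · rcases ds with _ | ⟨e, es⟩
          · exact .pair hc (by simpa [elimList, contract] using hρ)
          · exact .cons hc (by simpa [elimList, contract] using hρ)
        · rw [← hv, ← hρv, Set.disjoint_left]
          intro a ha ha'
          obtain ⟨x, hx, ha'⟩ := mem_attrs_node.1 ha'
          exact Set.disjoint_left.1 (hd x hx) ha ha'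
        · rw [attrs_cons, hv, hρv, PExpr.vars]
        · intro a b
          rw [precedes_cons, hp, hρp, hv, hρv, PExpr.Precedes]

theorem Represents.unique {T : SyntaxTree A} {π ρ : PExpr A} (h : T.Represents π)
    (h' : T.Represents ρ) : π = ρ := by
  induction h generalizing ρ with
  | leaf a =>
    cases h'
    rfl
  | pair _ _ ih₁ ih₂ =>
    cases h' with
    | pair h₁ h₂ => rw [ih₁ h₁, ih₂ h₂]
  | cons _ _ ih₁ ih₂ =>
    cases h' with
    | cons h₁ h₂ => rw [ih₁ h₁, ih₂ h₂]

/-! ### Cuts of syntax trees -/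

theorem Proper.uncuttable_par {c d : SyntaxTree A} {ds : List (SyntaxTree A)}
    (h : Proper 1 (.node .par (c :: d :: ds))) :
    Uncuttable (Precedes (.node .par (c :: d :: ds))) (attrs (.node .par (c :: d :: ds))) := by
  have hdisj := Proper.disjoint_append (l := [c]) (r := d :: ds) h
  have hp := (proper_node.1 h).2.1
  rw [attrs_cons, attrs_nil, Set.union_empty] at hdisj
  rw [attrs_cons]
  refine Uncuttable.union (hp c (by simp)).attrs_nonempty
    (attrs_node_nonempty (by simp) fun x hx => hp x (by simp [hx])) fun u hu v hv => ?_
  have hv' := Set.disjoint_right.1 hdisj hv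
  have hu' := Set.disjoint_left.1 hdisj hu
  constructor <;> rintro h <;> rcases precedes_cons.1 h with h | h | h
  · exact hv' h.mem_attrs.2
  · exact hu' h.mem_attrs.1
  · exact absurd h.1 (by simp)
  · exact hv' h.mem_attrs.1
  · exact hu' h.mem_attrs.2
  · exact absurd h.1 (by simp)

/-- Leaves and `⊗`-nodes cannot be decomposed in series. -/
theorem Proper.uncuttable_precedes {N : SyntaxTree A} (h : N.Proper 2)
    (hN : N.rootOp ≠ some .pri) : Uncuttable N.Precedes N.attrs := by
  rcases N with a | ⟨_ | _, cs⟩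
  · rw [attrs_leaf]
    exact .singleton _ a
  · rcases cs with _ | ⟨c, _ | ⟨d, ds⟩⟩
    · simpa using (proper_node.1 h).1
    · simpa using (proper_node.1 h).1
    · exact (h.mono one_le_two).uncuttable_par
  · exact absurd rfl hN

/-- Leaves and `&`-nodes cannot be decomposed in parallel. -/
theorem Proper.uncuttable_incomparable {N : SyntaxTree A} (h : N.Proper 2)
    (hN : N.rootOp ≠ some .par) {s : A → A → Prop} (hs : ∀ a b, N.Precedes a b → s a b) :
    Uncuttable (fun a b => ¬ s a b ∧ ¬ s b a) N.attrs := by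
  rcases N with a | ⟨_ | _, cs⟩
  · rw [attrs_leaf]
    exact .singleton _ a
  · exact absurd rfl hN
  · have hp := (proper_node.1 (h.mono one_le_two)).2.1
    rcases cs with _ | ⟨c, _ | ⟨d, ds⟩⟩
    · simpa using (proper_node.1 h).1
    · simpa using (proper_node.1 h).1
    · rw [attrs_cons]
      refine Uncuttable.union (hp c (by simp)).attrs_nonempty
        (attrs_node_nonempty (by simp) fun x hx => hp x (by simp [hx])) fun u hu v hv => ?_
      have := hs u v (precedes_cons.2 (.inr (.inr ⟨rfl, hu, hv⟩)))
      tauto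

/-- A series cut of an `&`-node whose children are not cut separates an initial segment of the
children from the remaining ones. -/
theorem exists_append_of_cut {s : A → A → Prop} (hs : ∀ a b, s a b → ¬ s b a) {P Q : Set A}
    (hPQ : ∀ p ∈ P, ∀ q ∈ Q, s p q) {Ns : List (SyntaxTree A)} (hne : ∀ N ∈ Ns, Proper 1 N)
    (hunc : ∀ N ∈ Ns, Uncuttable s N.attrs)
    (hNs : ∀ a b, Precedes (.node .pri Ns) a b → s a b) (hsub : attrs (.node .pri Ns) ⊆ P ∪ Q) :
    ∃ Ns₁ Ns₂, Ns = Ns₁ ++ Ns₂ ∧ attrs (.node .pri Ns₁) ⊆ P ∧ attrs (.node .pri Ns₂) ⊆ Q := by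
  induction Ns with
  | nil => exact ⟨[], [], rfl, by simp [attrs_nil], by simp [attrs_nil]⟩
  | cons N Ns ih =>
    rw [attrs_cons, Set.union_subset_iff] at hsub
    rcases hunc N (by simp) P Q hsub.1 hPQ with hN | hN
    · obtain ⟨Ns₁, Ns₂, rfl, h₁, h₂⟩ := ih (fun M hM => hne M (by simp [hM]))
        (fun M hM => hunc M (by simp [hM]))
        (fun a b h => hNs a b (precedes_cons.2 (.inr (.inl h)))) hsub.2
      refine ⟨N :: Ns₁, Ns₂, rfl, ?_, h₂⟩
      rw [attrs_cons]
      exact Set.union_subset hN h₁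
    · refine ⟨[], N :: Ns, rfl, by simp [attrs_nil], ?_⟩
      rw [attrs_cons]
      refine Set.union_subset hN fun y hy => (hsub.2 hy).resolve_left fun hyP => ?_
      obtain ⟨x, hx⟩ := (hne N (by simp)).attrs_nonempty
      exact hs y x (hPQ y hyP x (hN hx)) (hNs x y (precedes_cons.2 (.inr (.inr ⟨rfl, hx, hy⟩))))

/-- The three possible positions of a child of a `⊗`-node with respect to a series cut. -/
theorem Proper.cut_cases {C : SyntaxTree A} (h : C.Proper 2) (hn : C.Normalized)
    (hC : C.rootOp ≠ some .par) {s : A → A → Prop} (hs : ∀ a b, s a b → ¬ s b a)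
    (hle : ∀ a b, C.Precedes a b → s a b)
    (hge : ∀ a ∈ C.attrs, ∀ b ∈ C.attrs, s a b → C.Precedes a b) {P Q : Set A}
    (hPQ : ∀ p ∈ P, ∀ q ∈ Q, s p q) (hsub : C.attrs ⊆ P ∪ Q) :
    C.attrs ⊆ P ∨ C.attrs ⊆ Q ∨ ∃ Ns Ns', Ns ≠ [] ∧ Ns' ≠ [] ∧ C = .node .pri (Ns ++ Ns') ∧
      attrs (.node .pri Ns) ⊆ P ∧ attrs (.node .pri Ns') ⊆ Q := by
  rcases C with a | ⟨_ | _, cs⟩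
  · rw [attrs_leaf] at hsub ⊢
    rcases hsub rfl with ha | ha
    · exact .inl (by simpa using ha)
    · exact .inr (.inl (by simpa using ha))
  · exact absurd rfl hC
  · have hn' := normalized_node.1 hn
    have hp' := (proper_node.1 h).2.1
    obtain ⟨Ns, Ns', rfl, h₁, h₂⟩ := exists_append_of_cut hs hPQ
      (fun N hN => (hp' N hN).mono one_le_two)
      (fun N hN => ((hp' N hN).uncuttable_precedes (hn'.1 N hN)).mono fun a ha b hb hab =>
        h.precedes_child hN ha hb
          (hge a (attrs_subset_node hN ha) b (attrs_subset_node hN hb) hab)) hle hsub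
    rcases eq_or_ne Ns [] with rfl | hNs
    · exact .inr (.inl h₂)
    rcases eq_or_ne Ns' [] with rfl | hNs'
    · exact .inl (by simpa using h₁)
    exact .inr (.inr ⟨Ns, Ns', hNs, hNs', rfl, h₁, h₂⟩)

/-! ### The transformation rules -/

/-- Every rule produces a binary `&`-node, and the order which it induces extends those of `C` and
`C'` by the pairs from the first to the second child. -/
theorem PairRule.exists_eq {C C' E : SyntaxTree A} (h : PairRule C C' E) :
    ∃ E₁ E₂, E = .node .pri [E₁, E₂] ∧ E₁.attrs ∪ E₂.attrs = C.attrs ∪ C'.attrs ∧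
      ∀ a b, E.Precedes a b ↔
        C.Precedes a b ∨ C'.Precedes a b ∨ (a ∈ E₁.attrs ∧ b ∈ E₂.attrs) := by
  cases h <;>
  · refine ⟨_, _, rfl, ?_, fun a b => ?_⟩
    · ext
      simp [attrs_append, attrs_cons, attrs_nil, or_assoc, or_comm, or_left_comm]
    · simp only [precedes_append, precedes_cons, precedes_nil, attrs_cons, attrs_nil,
        Set.mem_union, Set.mem_empty_iff_false, reduceCtorEq, not_precedes_leaf]
      grind

theorem PairRule.attrs_eq {C C' E : SyntaxTree A} (h : PairRule C C' E) :
    E.attrs = C.attrs ∪ C'.attrs := by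
  obtain ⟨E₁, E₂, rfl, h, -⟩ := h.exists_eq
  simpa [attrs_cons, attrs_nil] using h

theorem disjoint_attrs_node {op : AccOp} {cs : List (SyntaxTree A)} {X : Set A} :
    Disjoint (attrs (.node op cs)) X ↔ ∀ c ∈ cs, Disjoint c.attrs X := by
  simp only [Set.disjoint_left, mem_attrs_node]
  grind

theorem disjoint_attrs_node' {op : AccOp} {cs : List (SyntaxTree A)} {X : Set A} :
    Disjoint X (attrs (.node op cs)) ↔ ∀ c ∈ cs, Disjoint X c.attrs := by
  simp only [disjoint_comm (a := X), disjoint_attrs_node]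

theorem PairRule.proper {C C' E : SyntaxTree A} (h : PairRule C C' E) (hC : C.Proper 1)
    (hC' : C'.Proper 1) (hd : Disjoint C.attrs C'.attrs) : E.Proper 1 := by
  cases h with
  | rule3 a b =>
    refine .node (by simp) (by simp [hC, hC']) (by simpa using hd)
  | _ =>
    simp only [proper_node, List.pairwise_cons, List.pairwise_append, List.forall_mem_append,
      List.forall_mem_cons, disjoint_attrs_node, disjoint_attrs_node', List.not_mem_nil,
      false_imp_iff, implies_true, List.length_append, List.length_cons, List.length_nil] at hC hC' hd ⊢
    simp only [← List.length_pos_iff] at *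
    grind

theorem PairRule.cross {C C' E₁ E₂ : SyntaxTree A} (h : PairRule C C' (.node .pri [E₁, E₂]))
    (hC : C.Proper 1) (hC' : C'.Proper 1) :
    ∃ x ∈ C.attrs, ∃ y ∈ C'.attrs, (x ∈ E₁.attrs ∧ y ∈ E₂.attrs) ∨
      (y ∈ E₁.attrs ∧ x ∈ E₂.attrs) := by
  obtain ⟨y, hy⟩ := hC'.attrs_nonempty
  cases h with
  | rule1 N Ns C hNs =>
    obtain ⟨x, hx⟩ := ((proper_node.1 hC).2.1 E₁ (by simp)).attrs_nonempty
    exact ⟨x, by simp [attrs_cons, hx], y, hy, .inl ⟨hx, by simp [attrs_cons, hy]⟩⟩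
  | rule2 Ns N C hNs =>
    obtain ⟨x, hx⟩ := ((proper_node.1 hC).2.1 E₂ (by simp)).attrs_nonempty
    exact ⟨x, by simp [attrs_append, attrs_cons, hx], y, hy, .inr ⟨by simp [attrs_cons, hy], hx⟩⟩
  | rule3 a b => exact ⟨a, .leaf a, b, .leaf b, .inl ⟨.leaf a, .leaf b⟩⟩
  | rule4 Ns Ns' Ms Ms' hNs hNs' hMs hMs' =>
    obtain ⟨x, hx⟩ := attrs_node_nonempty (op := .pri) hNs
      fun c hc => (proper_node.1 hC).2.1 c (by simp [hc])
    obtain ⟨y, hy⟩ := attrs_node_nonempty (op := .pri) hMs'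
      fun c hc => (proper_node.1 hC').2.1 c (by simp [hc])
    exact ⟨x, by simp [attrs_append, hx], y, by simp [attrs_append, hy],
      .inl ⟨by simp [attrs_cons, hx], by simp [attrs_cons, hy]⟩⟩

/-- A rule adds no pairs inside `C` or inside `C'`. -/
theorem PairRule.precedes_inside {C C' E : SyntaxTree A} (h : PairRule C C' E)
    (hC : C.Proper 1) (hC' : C'.Proper 1) (hd : Disjoint C.attrs C'.attrs) {a b : A}
    (hab : E.Precedes a b) :
    (a ∈ C.attrs → b ∈ C.attrs → C.Precedes a b) ∧
      (a ∈ C'.attrs → b ∈ C'.attrs → C'.Precedes a b) := by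
  have hda : a ∈ C.attrs → a ∉ C'.attrs := fun h => Set.disjoint_left.1 hd h
  have hdb : b ∈ C.attrs → b ∉ C'.attrs := fun h => Set.disjoint_left.1 hd h
  have hm := fun {T : SyntaxTree A} (h : T.Precedes a b) => h.mem_attrs
  cases h with
  | rule3 c d =>
    simp only [precedes_cons, precedes_nil, attrs_cons, attrs_nil, Set.mem_union,
      Set.mem_empty_iff_false, not_precedes_leaf] at *
    grind
  | rule1 N Ns =>
    have h1 := fun h => (@hm N h)
    have h2 := fun h => (@hm (.node .pri Ns) h)
    have h3 := fun h => (@hm C' h)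
    simp only [precedes_cons, precedes_nil, attrs_cons, attrs_nil, Set.mem_union,
      Set.mem_empty_iff_false, reduceCtorEq] at hab hda hdb ⊢
    grind
  | rule2 Ns N =>
    have h1 := fun h => (@hm N h)
    have h2 := fun h => (@hm (.node .pri Ns) h)
    have h3 := fun h => (@hm C' h)
    simp only [precedes_cons, precedes_append, precedes_nil, attrs_cons, attrs_append, attrs_nil,
      Set.mem_union, Set.mem_empty_iff_false, reduceCtorEq] at hab hda hdb ⊢
    grind
  | rule4 Ns Ns' Ms Ms' =>
    have h1 := fun h => (@hm (.node .pri Ns) h)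
    have h2 := fun h => (@hm (.node .pri Ns') h)
    have h3 := fun h => (@hm (.node .pri Ms) h)
    have h4 := fun h => (@hm (.node .pri Ms') h)
    simp only [precedes_cons, precedes_append, precedes_nil, attrs_cons, attrs_append, attrs_nil,
      Set.mem_union, Set.mem_empty_iff_false, reduceCtorEq] at hab hda hdb ⊢
    grind

/-- Neither child of the node produced by a rule can be decomposed in series, so that the only
series cut of this node is the one between its two children. -/
theorem PairRule.uncuttable {C C' E₁ E₂ : SyntaxTree A} (h : PairRule C C' (.node .pri [E₁, E₂]))
    (hC : C.Proper 2) (hC' : C'.Proper 2) (hn : C.Normalized) (hd : Disjoint C.attrs C'.attrs) :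
    Uncuttable E₁.Precedes E₁.attrs ∧ Uncuttable E₂.Precedes E₂.attrs := by
  have hE := h.proper (hC.mono one_le_two) (hC'.mono one_le_two) hd
  have h₁ := (proper_node.1 hE).2.1 E₁ (by simp)
  have h₂ := (proper_node.1 hE).2.1 E₂ (by simp)
  cases h with
  | rule1 N Ns =>
    exact ⟨((proper_node.1 hC).2.1 E₁ (by simp)).uncuttable_precedes
      ((normalized_node.1 hn).1 E₁ (by simp)), h₂.uncuttable_par⟩
  | rule2 Ns N =>
    exact ⟨h₁.uncuttable_par, ((proper_node.1 hC).2.1 E₂ (by simp)).uncuttable_precedes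
      ((normalized_node.1 hn).1 E₂ (by simp))⟩
  | rule3 a b =>
    exact ⟨Proper.uncuttable_precedes (.leaf a) (by simp [rootOp]),
      Proper.uncuttable_precedes (.leaf b) (by simp [rootOp])⟩
  | rule4 => exact ⟨h₁.uncuttable_par, h₂.uncuttable_par⟩

/-- An order above those of `C` and `C'` is above that of the result of a rule as soon as it
contains the pairs from the first to the second child of the new node. -/
theorem PairRule.precedes_le {C C' E₁ E₂ : SyntaxTree A}
    (h : PairRule C C' (.node .pri [E₁, E₂])) {s : A → A → Prop}
    (hC : ∀ a b, C.Precedes a b → s a b) (hC' : ∀ a b, C'.Precedes a b → s a b)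
    (hE : ∀ a ∈ E₁.attrs, ∀ b ∈ E₂.attrs, s a b) (a b : A)
    (hab : Precedes (.node .pri [E₁, E₂]) a b) : s a b := by
  obtain ⟨F₁, F₂, e, -, hF⟩ := h.exists_eq
  simp only [node.injEq, List.cons.injEq, true_and, and_true] at e
  obtain ⟨rfl, rfl⟩ := e
  rcases (hF a b).1 hab with h | h | h
  exacts [hC a b h, hC' a b h, hE a h.1 b h.2]

/-- The first rule stays below `s` if the first child of the `&`-node precedes `C'` in `s`. -/
theorem exists_pairRule_head {N C' : SyntaxTree A} {Ns : List (SyntaxTree A)} (hNs : Ns ≠ [])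
    {s : A → A → Prop} (hle : ∀ a b, Precedes (.node .pri (N :: Ns)) a b → s a b)
    (hle' : ∀ a b, C'.Precedes a b → s a b) (h : ∀ a ∈ N.attrs, ∀ b ∈ C'.attrs, s a b) :
    ∃ E, PairRule (.node .pri (N :: Ns)) C' E ∧ ∀ a b, E.Precedes a b → s a b := by
  refine ⟨_, .rule1 N Ns C' hNs, (PairRule.rule1 N Ns C' hNs).precedes_le hle hle' ?_⟩
  intro a ha b hb
  simp only [attrs_cons, attrs_nil, Set.union_empty] at hb
  rcases hb with hb | hb
  · exact hle a b (precedes_cons.2 (.inr (.inr ⟨rfl, ha, hb⟩)))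
  · exact h a ha b hb

/-- The second rule stays below `s` if `C'` precedes the last child of the `&`-node in `s`. -/
theorem exists_pairRule_last {N C' : SyntaxTree A} {Ns : List (SyntaxTree A)} (hNs : Ns ≠ [])
    {s : A → A → Prop} (hle : ∀ a b, Precedes (.node .pri (Ns ++ [N])) a b → s a b)
    (hle' : ∀ a b, C'.Precedes a b → s a b) (h : ∀ a ∈ C'.attrs, ∀ b ∈ N.attrs, s a b) :
    ∃ E, PairRule (.node .pri (Ns ++ [N])) C' E ∧ ∀ a b, E.Precedes a b → s a b := by
  refine ⟨_, .rule2 Ns N C' hNs, (PairRule.rule2 Ns N C' hNs).precedes_le hle hle' ?_⟩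
  intro a ha b hb
  simp only [attrs_cons, attrs_nil, Set.union_empty] at ha
  rcases ha with ha | ha
  · exact h a ha b hb
  · exact hle a b (precedes_append.2 (.inr (.inr ⟨rfl, ha, by simpa [attrs_cons, attrs_nil]⟩)))

theorem exists_pairRule_of_suffix {C' : SyntaxTree A} {Ns Ns' : List (SyntaxTree A)}
    (hNs : Ns ≠ []) (hNs' : Ns' ≠ []) {s : A → A → Prop}
    (hle : ∀ a b, Precedes (.node .pri (Ns ++ Ns')) a b → s a b)
    (hle' : ∀ a b, C'.Precedes a b → s a b)
    (h : ∀ a ∈ C'.attrs, ∀ b ∈ attrs (.node .pri Ns'), s a b) :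
    ∃ E, PairRule (.node .pri (Ns ++ Ns')) C' E ∧ ∀ a b, E.Precedes a b → s a b := by
  rw [← List.dropLast_append_getLast hNs', ← List.append_assoc] at hle ⊢
  exact exists_pairRule_last (by simp [hNs]) hle hle' fun a ha b hb =>
    h a ha b (attrs_subset_node (List.getLast_mem hNs') hb)

theorem exists_pairRule_of_prefix {C' : SyntaxTree A} {Ns Ns' : List (SyntaxTree A)}
    (hNs : Ns ≠ []) (hNs' : Ns' ≠ []) {s : A → A → Prop}
    (hle : ∀ a b, Precedes (.node .pri (Ns ++ Ns')) a b → s a b)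
    (hle' : ∀ a b, C'.Precedes a b → s a b)
    (h : ∀ a ∈ attrs (.node .pri Ns), ∀ b ∈ C'.attrs, s a b) :
    ∃ E, PairRule (.node .pri (Ns ++ Ns')) C' E ∧ ∀ a b, E.Precedes a b → s a b := by
  rw [← List.cons_head_tail hNs, List.cons_append] at hle ⊢
  exact exists_pairRule_head (by simp [hNs']) hle hle' fun a ha b hb =>
    h a (attrs_subset_node (List.head_mem hNs) ha) b hb

theorem Proper.exists_node_append {C : SyntaxTree A} (hC : C.Proper 2)
    (hr : C.rootOp ≠ some .par) :
    (∃ a, C = .leaf a) ∨ ∃ Ns Ns', Ns ≠ [] ∧ Ns' ≠ [] ∧ C = .node .pri (Ns ++ Ns') := by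
  rcases C with a | ⟨_ | _, cs⟩
  · exact .inl ⟨a, rfl⟩
  · exact absurd rfl hr
  · rcases cs with _ | ⟨c, _ | ⟨d, ds⟩⟩
    · simpa using (proper_node.1 hC).1
    · simpa using (proper_node.1 hC).1
    · exact .inr ⟨[c], d :: ds, by simp, by simp, rfl⟩

/-- If `C` precedes `C'` completely, then a rule applies whatever the kinds of the two nodes: the
third one to two leaves, otherwise the first or the second one to an `&`-node among them. -/
theorem exists_pairRule_of_all {C C' : SyntaxTree A} (hC : C.Proper 2) (hC' : C'.Proper 2)
    (hr : C.rootOp ≠ some .par) (hr' : C'.rootOp ≠ some .par) {s : A → A → Prop}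
    (hle : ∀ a b, C.Precedes a b → s a b) (hle' : ∀ a b, C'.Precedes a b → s a b)
    (h : ∀ a ∈ C.attrs, ∀ b ∈ C'.attrs, s a b) :
    ∃ E, (PairRule C C' E ∨ PairRule C' C E) ∧ ∀ a b, E.Precedes a b → s a b := by
  rcases hC.exists_node_append hr with ⟨x, rfl⟩ | ⟨Ns, Ns', hNs, hNs', rfl⟩
  · rcases hC'.exists_node_append hr' with ⟨y, rfl⟩ | ⟨Ms, Ms', hMs, hMs', rfl⟩
    · exact ⟨_, .inl (.rule3 x y), (PairRule.rule3 x y).precedes_le hle hle' h⟩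
    · obtain ⟨E, hE, hEs⟩ := exists_pairRule_of_suffix hMs hMs' hle' hle
        fun a ha b hb => h a ha b (attrs_append _ _ _ ▸ .inr hb)
      exact ⟨E, .inr hE, hEs⟩
  · obtain ⟨E, hE, hEs⟩ := exists_pairRule_of_prefix hNs hNs' hle hle'
      fun a ha b hb => h a (attrs_append _ _ _ ▸ .inl ha) b hb
    exact ⟨E, .inl hE, hEs⟩

/-- Let `C` and `C'` be children of a `⊗`-node and let a series-parallel order `s` relate some
attribute of `C` to one of `C'` while agreeing with the orders of `C` and `C'` on each of them.
Then `s` decomposes `C ∪ C'` in series, and the position of `C` and `C'` with respect to this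
cut tells which rule stays below `s`. -/
theorem exists_pairRule {C C' : SyntaxTree A} (hC : C.Proper 2) (hC' : C'.Proper 2)
    (hn : C.Normalized) (hn' : C'.Normalized) (hd : Disjoint C.attrs C'.attrs)
    (hr : C.rootOp ≠ some .par) (hr' : C'.rootOp ≠ some .par) {s : A → A → Prop}
    (hs : SeriesParallel s) (hle : ∀ a b, C.Precedes a b → s a b)
    (hle' : ∀ a b, C'.Precedes a b → s a b)
    (hge : ∀ a ∈ C.attrs, ∀ b ∈ C.attrs, s a b → C.Precedes a b)
    (hge' : ∀ a ∈ C'.attrs, ∀ b ∈ C'.attrs, s a b → C'.Precedes a b)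
    {x y : A} (hx : x ∈ C.attrs) (hy : y ∈ C'.attrs) (hxy : s x y ∨ s y x) :
    ∃ E, (PairRule C C' E ∨ PairRule C' C E) ∧ ∀ a b, E.Precedes a b → s a b := by
  obtain ⟨P, Q, ⟨p, hp⟩, ⟨q, hq⟩, hU, hPQ⟩ := hs.exists_series hd
    (hC.uncuttable_incomparable hr hle) (hC'.uncuttable_incomparable hr' hle') hx hy hxy
  have hsub : C.attrs ⊆ P ∪ Q := hU ▸ Set.subset_union_left
  have hsub' : C'.attrs ⊆ P ∪ Q := hU ▸ Set.subset_union_right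
  have hself : ∀ z, ¬ s z z := fun z hz => hs.asymm z z hz hz
  rcases hC.cut_cases hn hr hs.asymm hle hge hPQ hsub with h | h | ⟨Ns, Ns', hNs, hNs', rfl, h₁, h₂⟩
  · rcases hC'.cut_cases hn' hr' hs.asymm hle' hge' hPQ hsub' with
      h' | h' | ⟨Ms, Ms', hMs, hMs', rfl, h₁', h₂'⟩
    · exact absurd (hPQ q (Set.union_subset h h' (hU ▸ .inr hq)) q hq) (hself q)
    · exact exists_pairRule_of_all hC hC' hr hr' hle hle'
        fun a ha b hb => hPQ a (h ha) b (h' hb)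
    · obtain ⟨E, hE, hEs⟩ := exists_pairRule_of_suffix hMs hMs' hle' hle
        fun a ha b hb => hPQ a (h ha) b (h₂' hb)
      exact ⟨E, .inr hE, hEs⟩
  · rcases hC'.cut_cases hn' hr' hs.asymm hle' hge' hPQ hsub' with
      h' | h' | ⟨Ms, Ms', hMs, hMs', rfl, h₁', h₂'⟩
    · obtain ⟨E, hE, hEs⟩ := exists_pairRule_of_all hC' hC hr' hr hle' hle
        fun a ha b hb => hPQ a (h' ha) b (h hb)
      exact ⟨E, hE.symm, hEs⟩
    · exact absurd (hPQ p hp p (Set.union_subset h h' (hU ▸ .inl hp))) (hself p)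
    · obtain ⟨E, hE, hEs⟩ := exists_pairRule_of_prefix hMs hMs' hle' hle
        fun a ha b hb => hPQ a (h₁' ha) b (h hb)
      exact ⟨E, .inr hE, hEs⟩
  · rcases hC'.cut_cases hn' hr' hs.asymm hle' hge' hPQ hsub' with
      h' | h' | ⟨Ms, Ms', hMs, hMs', rfl, h₁', h₂'⟩
    · obtain ⟨E, hE, hEs⟩ := exists_pairRule_of_suffix hNs hNs' hle hle'
        fun a ha b hb => hPQ a (h' ha) b (h₂ hb)
      exact ⟨E, .inl hE, hEs⟩
    · obtain ⟨E, hE, hEs⟩ := exists_pairRule_of_prefix hNs hNs' hle hle'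
        fun a ha b hb => hPQ a (h₁ ha) b (h' hb)
      exact ⟨E, .inl hE, hEs⟩
    · refine ⟨_, .inl (.rule4 Ns Ns' Ms Ms' hNs hNs' hMs hMs'),
        (PairRule.rule4 Ns Ns' Ms Ms' hNs hNs' hMs hMs').precedes_le hle hle' ?_⟩
      intro a ha b hb
      simp only [attrs_cons, attrs_nil, Set.union_empty] at ha hb
      exact hPQ a (ha.elim (h₁ ·) (h₁' ·)) b (hb.elim (h₂ ·) (h₂' ·))

/-! ### Rule applications inside a tree -/

/-- Induction on rule applications, where a rule at a `⊗`-node is described up to the order of the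
children, which is irrelevant to the induced relation. -/
theorem RuleStep.induction_perm {motive : ∀ T T' : SyntaxTree A, RuleStep T T' → Prop}
    (merge : ∀ {C C' E : SyntaxTree A} {cs cs' rest : List (SyntaxTree A)}, PairRule C C' E →
      cs.Perm (C :: C' :: rest) → cs'.Perm (E :: rest) →
      ∀ h : RuleStep (.node .par cs) (.node .par cs'), motive _ _ h)
    (inside : ∀ {op : AccOp} {c c' : SyntaxTree A} (l r : List (SyntaxTree A))
      (h : RuleStep c c'), motive c c' h → motive _ _ (.inside (op := op) l r h))
    {T T' : SyntaxTree A} (h : RuleStep T T') : motive T T' h := by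
  induction h with
  | @ordered C C' E l₁ l₂ l₃ h =>
    refine merge (rest := l₁ ++ (l₂ ++ l₃)) h ?_ List.perm_middle _
    refine List.perm_middle.trans (.cons _ ?_)
    rw [← List.append_assoc, ← List.append_assoc]
    exact List.perm_middle
  | @swapped C C' E l₁ l₂ l₃ h =>
    refine merge (rest := l₁ ++ (l₂ ++ l₃)) h ?_ List.perm_middle _
    refine (List.perm_middle.trans (.cons _ ?_)).trans (.swap _ _ _)
    rw [← List.append_assoc, ← List.append_assoc]
    exact List.perm_middle
  | inside l r h ih => exact inside l r h ih

theorem RuleStep.attrs_eq {T T' : SyntaxTree A} (h : RuleStep T T') : T'.attrs = T.attrs := by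
  induction h using RuleStep.induction_perm with
  | merge h hcs hcs' =>
    ext a
    have := Set.ext_iff.1 h.attrs_eq a
    simp only [mem_attrs_node, hcs.mem_iff, hcs'.mem_iff, List.mem_cons, Set.mem_union,
      exists_eq_or_imp] at this ⊢
    rw [this, or_assoc]
  | inside l r _ ih => simp only [attrs_append, attrs_cons, ih]

theorem proper_par_perm {k : ℕ} {cs ds : List (SyntaxTree A)} (h : cs.Perm ds) :
    Proper k (.node .par cs) ↔ Proper k (.node .par ds) := by
  rw [proper_node, proper_node, h.length_eq, h.pairwise_iff fun {_ _} h => h.symm]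
  simp only [h.mem_iff]

theorem RuleStep.proper {T T' : SyntaxTree A} (h : RuleStep T T') (hT : T.Proper 1) :
    T'.Proper 1 := by
  induction h using RuleStep.induction_perm with
  | @merge C C' E cs cs' rest h hcs hcs' =>
    rw [proper_par_perm hcs] at hT
    rw [proper_par_perm hcs']
    simp only [proper_node, List.forall_mem_cons, List.pairwise_cons] at hT ⊢
    obtain ⟨-, ⟨hC, hC', hrest⟩, ⟨hd, hCr⟩, hCr', hdr⟩ := hT
    refine ⟨by simp, ⟨h.proper hC hC' hd, hrest⟩, fun d hd' => ?_, hdr⟩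
    rw [h.attrs_eq]
    exact (hCr d hd').union_left (hCr' d hd')
  | inside l r h ih =>
    simp only [proper_node, List.forall_mem_cons, List.forall_mem_append, List.pairwise_append,
      List.pairwise_cons, h.attrs_eq, List.length_append, List.length_cons] at hT ⊢
    exact ⟨hT.1, ⟨hT.2.1.1, ih hT.2.1.2.1, hT.2.1.2.2⟩, hT.2.2⟩

theorem RuleStep.precedes_mono {T T' : SyntaxTree A} (h : RuleStep T T') {a b : A}
    (hab : T.Precedes a b) : T'.Precedes a b := by
  induction h using RuleStep.induction_perm with
  | merge h hcs hcs' =>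
    obtain ⟨E₁, E₂, -, -, hE⟩ := h.exists_eq
    rw [precedes_par] at hab ⊢
    simp only [hcs.mem_iff, hcs'.mem_iff, List.mem_cons, exists_eq_or_imp] at hab ⊢
    rcases hab with h | h | h
    · exact .inl ((hE a b).2 (.inl h))
    · exact .inl ((hE a b).2 (.inr (.inl h)))
    · exact .inr h
  | inside l r h ih =>
    simp only [precedes_append, precedes_cons, attrs_cons, h.attrs_eq] at hab ⊢
    exact hab.imp_right (Or.imp_left (Or.imp_left ih))

/-- Monotonicity of the order of a node in one of its children. -/
theorem precedes_node_le {op : AccOp} {c c' : SyntaxTree A} {l r : List (SyntaxTree A)}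
    (hattrs : c'.attrs = c.attrs) {s : A → A → Prop}
    (hle : ∀ a b, Precedes (.node op (l ++ c :: r)) a b → s a b)
    (hc' : ∀ a b, c'.Precedes a b → s a b) (a b : A)
    (hab : Precedes (.node op (l ++ c' :: r)) a b) : s a b := by
  have := hle a b
  simp only [precedes_append, precedes_cons, attrs_cons, hattrs] at hab this
  grind

/-- Every rule application enlarges the order. -/
theorem RuleStep.exists_new {T T' : SyntaxTree A} (h : RuleStep T T') (hT : T.Proper 1) :
    ∃ a b, T'.Precedes a b ∧ ¬ T.Precedes a b := by
  induction h using RuleStep.induction_perm with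
  | @merge C C' E cs cs' rest h hcs hcs' =>
    have hp := proper_node.1 hT
    have hCm : C ∈ cs := hcs.mem_iff.2 (by simp)
    have hCm' : C' ∈ cs := hcs.mem_iff.2 (by simp)
    obtain ⟨E₁, E₂, rfl, -, hE⟩ := h.exists_eq
    obtain ⟨x, hx, y, hy, hxy⟩ := h.cross (hp.2.1 C hCm) (hp.2.1 C' hCm')
    have hd : Disjoint C.attrs C'.attrs := by
      rw [proper_par_perm hcs, proper_node] at hT
      exact (List.pairwise_cons.1 hT.2.2).1 C' (by simp)
    have key : ∀ c ∈ cs, x ∈ c.attrs → y ∉ c.attrs := by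
      intro c hc hxc hyc
      obtain rfl := hT.eq_of_mem hc hCm hxc hx
      exact Set.disjoint_left.1 hd hyc hy
    rcases hxy with hxy | hxy
    · refine ⟨x, y, precedes_par.2 ⟨_, hcs'.mem_iff.2 (by simp), (hE x y).2 (.inr (.inr hxy))⟩, ?_⟩
      rintro h
      obtain ⟨c, hc, h⟩ := precedes_par.1 h
      exact key c hc h.mem_attrs.1 h.mem_attrs.2
    · refine ⟨y, x, precedes_par.2 ⟨_, hcs'.mem_iff.2 (by simp), (hE y x).2 (.inr (.inr hxy))⟩, ?_⟩
      rintro h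
      obtain ⟨c, hc, h⟩ := precedes_par.1 h
      exact key c hc h.mem_attrs.2 h.mem_attrs.1
  | @inside op c c' l r h ih =>
    obtain ⟨a, b, hab, hab'⟩ := ih ((proper_node.1 hT).2.1 c (by simp))
    refine ⟨a, b, .inside (c := c') (by simp) hab, fun h' => hab' ?_⟩
    have := hab.mem_attrs
    rw [h.attrs_eq] at this
    exact hT.precedes_child (by simp) this.1 this.2 h'

/-- Completeness of the rules: every series-parallel order properly extending the order of a
normalized tree contains the order of the result of some rule application. -/
theorem exists_ruleStep {T : SyntaxTree A} (hn : T.Normalized) (hT : T.Proper 2)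
    {s : A → A → Prop} (hs : SeriesParallel s) (hle : ∀ a b, T.Precedes a b → s a b)
    (hnew : ∃ a ∈ T.attrs, ∃ b ∈ T.attrs, s a b ∧ ¬ T.Precedes a b) :
    ∃ T', RuleStep T T' ∧ ∀ a b, T'.Precedes a b → s a b := by
  induction hn with
  | leaf x =>
    obtain ⟨a, ha, b, hb, h, -⟩ := hnew
    rw [attrs_leaf, Set.mem_singleton_iff] at ha hb
    subst ha hb
    exact absurd h (hs.asymm _ _ h)
  | @node op cs hop hncs ih =>
    have hp := proper_node.1 hT
    have hle' : ∀ c ∈ cs, ∀ a b, c.Precedes a b → s a b := fun c hc a b h => hle a b (.inside hc h)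
    by_cases hin : ∃ c ∈ cs, ∃ a ∈ c.attrs, ∃ b ∈ c.attrs, s a b ∧ ¬ c.Precedes a b
    · obtain ⟨c, hc, hnew⟩ := hin
      obtain ⟨c', hstep, hc'⟩ := ih c hc (hp.2.1 c hc) (hle' c hc) hnew
      obtain ⟨l, r, rfl⟩ := List.append_of_mem hc
      exact ⟨_, .inside l r hstep, precedes_node_le hstep.attrs_eq hle hc'⟩
    · push Not at hin
      obtain ⟨x, hxT, y, hyT, hxy, hxyT⟩ := hnew
      obtain ⟨c, hc, hx⟩ := mem_attrs_node.1 hxT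
      obtain ⟨c', hc', hy⟩ := mem_attrs_node.1 hyT
      have hne : c ≠ c' := by
        rintro rfl
        exact hxyT (.inside hc (hin c hc x hx y hy hxy))
      cases op with
      | pri =>
        exfalso
        rcases precedes_pri_total hc hc' hne hx hy with h | h
        · exact hxyT h
        · exact hs.asymm x y hxy (hle y x h)
      | par =>
        have hd : Disjoint c.attrs c'.attrs :=
          Set.disjoint_left.2 fun a ha ha' => hne (hT.eq_of_mem hc hc' ha ha')
        obtain ⟨E, hE, hEs⟩ := exists_pairRule (hp.2.1 c hc) (hp.2.1 c' hc') (hncs c hc)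
          (hncs c' hc') hd (hop c hc) (hop c' hc') hs (hle' c hc) (hle' c' hc') (hin c hc)
          (hin c' hc') hx hy (.inl hxy)
        have hfin : ∀ l₁ l₂ l₃ : List (SyntaxTree A), (∀ d ∈ l₁ ++ (l₂ ++ l₃), d ∈ cs) →
            ∀ a b, Precedes (.node .par (l₁ ++ E :: (l₂ ++ l₃))) a b → s a b := by
          intro l₁ l₂ l₃ hl a b hab
          obtain ⟨d, hd, h⟩ := precedes_par.1 hab
          rcases List.mem_cons.1 (List.perm_middle.mem_iff.1 hd) with rfl | hd
          · exact hEs a b h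
          · exact hle' d (hl d hd) a b h
        obtain ⟨l₁, l₂, l₃, rfl | rfl⟩ := exists_eq_append_of_mem_of_ne hc hc' hne
        · refine ⟨.node .par (l₁ ++ E :: (l₂ ++ l₃)), ?_, hfin l₁ l₂ l₃ (by grind)⟩
          rcases hE with hE | hE
          exacts [.ordered l₁ l₂ l₃ hE, .swapped l₁ l₂ l₃ hE]
        · refine ⟨.node .par (l₁ ++ E :: (l₂ ++ l₃)), ?_, hfin l₁ l₂ l₃ (by grind)⟩
          rcases hE with hE | hE
          exacts [.swapped l₁ l₂ l₃ hE, .ordered l₁ l₂ l₃ hE]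

/-- Minimality of the rules: a series-parallel order strictly above the order of `T` and below
that of the result `T'` of a rule application to `T` coincides with the latter. Indeed, it
decomposes the attributes of the merged children in series, and the order of `T'` admits only the
cut between the two children of the new `&`-node, so all new pairs are present. -/
theorem RuleStep.precedes_le {T T' : SyntaxTree A} (h : RuleStep T T') (hn : T.Normalized)
    (hT : T.Proper 2) {s : A → A → Prop} (hs : SeriesParallel s)
    (hle : ∀ a b, T.Precedes a b → s a b)
    (hge : ∀ a ∈ T.attrs, ∀ b ∈ T.attrs, s a b → T'.Precedes a b)
    (hnew : ∃ a ∈ T.attrs, ∃ b ∈ T.attrs, s a b ∧ ¬ T.Precedes a b) :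
    ∀ a b, T'.Precedes a b → s a b := by
  have hT' := h.proper (hT.mono one_le_two)
  induction h using RuleStep.induction_perm with
  | @merge C C' E cs cs' rest h hcs hcs' =>
    obtain ⟨-, hp, -⟩ := proper_node.1 hT
    obtain ⟨hop, hncs⟩ := normalized_node.1 hn
    have hCm : C ∈ cs := hcs.mem_iff.2 (by simp)
    have hCm' : C' ∈ cs := hcs.mem_iff.2 (by simp)
    have hEm : E ∈ cs' := hcs'.mem_iff.2 (by simp)
    have hd : Disjoint C.attrs C'.attrs := by
      rw [proper_par_perm hcs, proper_node] at hT
      exact (List.pairwise_cons.1 hT.2.2).1 C' (by simp)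
    have hC1 := (hp C hCm).mono one_le_two
    have hC1' := (hp C' hCm').mono one_le_two
    have hleC : ∀ a b, C.Precedes a b → s a b := fun a b h => hle a b (.inside hCm h)
    have hleC' : ∀ a b, C'.Precedes a b → s a b := fun a b h => hle a b (.inside hCm' h)
    have hEattrs : E.attrs = C.attrs ∪ C'.attrs := h.attrs_eq
    have hET : ∀ a ∈ E.attrs, a ∈ attrs (.node .par cs) := by
      intro a ha
      rw [hEattrs] at ha
      exact ha.elim (attrs_subset_node hCm ·) (attrs_subset_node hCm' ·)
    have hsE : ∀ a ∈ E.attrs, ∀ b ∈ E.attrs, s a b → E.Precedes a b := fun a ha b hb hab =>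
      hT'.precedes_child hEm ha hb (hge a (hET a ha) b (hET b hb) hab)
    -- The new pair of `s` relates an attribute of `C` and one of `C'`.
    obtain ⟨x, hx, y, hy, hxy⟩ : ∃ x ∈ C.attrs, ∃ y ∈ C'.attrs, s x y ∨ s y x := by
      obtain ⟨a, ha, b, hb, hab, habT⟩ := hnew
      obtain ⟨d, hd', habd⟩ := precedes_par.1 (hge a ha b hb hab)
      rcases List.mem_cons.1 (hcs'.mem_iff.1 hd') with rfl | hd'
      · have hin := h.precedes_inside hC1 hC1' hd habd
        have hm := habd.mem_attrs
        rw [hEattrs] at hm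
        rcases hm with ⟨ha | ha, hb | hb⟩
        · exact absurd (.inside hCm (hin.1 ha hb)) habT
        · exact ⟨a, ha, b, hb, .inl hab⟩
        · exact ⟨b, hb, a, ha, .inr hab⟩
        · exact absurd (.inside hCm' (hin.2 ha hb)) habT
      · exact absurd (.inside (hcs.mem_iff.2 (by simp [hd'])) habd) habT
    obtain ⟨P, Q, ⟨p, hpP⟩, ⟨q, hqQ⟩, hU, hPQ⟩ := hs.exists_series hd
      ((hp C hCm).uncuttable_incomparable (hop C hCm) hleC)
      ((hp C' hCm').uncuttable_incomparable (hop C' hCm') hleC') hx hy hxy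
    have hself : ∀ z, ¬ s z z := fun z hz => hs.asymm z z hz hz
    rw [← hEattrs] at hU
    obtain ⟨E₁, E₂, rfl, -, -⟩ := h.exists_eq
    have hEP := proper_node.1 ((proper_node.1 hT').2.1 _ hEm)
    obtain ⟨hu₁, hu₂⟩ := h.uncuttable (hp C hCm) (hp C' hCm') (hncs C hCm) hd
    have hsub₁ : E₁.attrs ⊆ attrs (.node .pri [E₁, E₂]) := attrs_subset_node (by simp)
    have hsub₂ : E₂.attrs ⊆ attrs (.node .pri [E₁, E₂]) := attrs_subset_node (by simp)
    have hE12 : Disjoint E₁.attrs E₂.attrs := (List.pairwise_cons.1 hEP.2.2).1 E₂ (by simp)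
    have hcut₁ := (hu₁.mono fun a ha b hb hab => Proper.precedes_child (.node hEP.1 hEP.2.1 hEP.2.2)
      (by simp) ha hb (hsE a (hsub₁ ha) b (hsub₁ hb) hab)) P Q (hU ▸ hsub₁) hPQ
    have hcut₂ := (hu₂.mono fun a ha b hb hab => Proper.precedes_child (.node hEP.1 hEP.2.1 hEP.2.2)
      (by simp) ha hb (hsE a (hsub₂ ha) b (hsub₂ hb) hab)) P Q (hU ▸ hsub₂) hPQ
    have hUE : P ∪ Q = E₁.attrs ∪ E₂.attrs := by
      simpa only [attrs_cons, attrs_nil, Set.union_empty] using hU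
    have hEs : ∀ a ∈ E₁.attrs, ∀ b ∈ E₂.attrs, s a b := by
      rcases hcut₁ with h₁ | h₁ <;> rcases hcut₂ with h₂ | h₂
      · exact absurd (hPQ q (Set.union_subset h₁ h₂ (hUE ▸ .inr hqQ)) q hqQ) (hself q)
      · exact fun a ha b hb => hPQ a (h₁ ha) b (h₂ hb)
      · exfalso
        obtain ⟨a, ha⟩ := (hEP.2.1 E₁ (by simp)).attrs_nonempty
        obtain ⟨b, hb⟩ := (hEP.2.1 E₂ (by simp)).attrs_nonempty
        have hba := hsE b (hsub₂ hb) a (hsub₁ ha) (hPQ b (h₂ hb) a (h₁ ha))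
        simp only [precedes_cons, precedes_nil, attrs_cons, attrs_nil, Set.union_empty,
          Set.mem_empty_iff_false, and_false, or_false] at hba
        rcases hba with h | h | ⟨-, h, -⟩
        · exact Set.disjoint_left.1 hE12 h.mem_attrs.1 hb
        · exact Set.disjoint_left.1 hE12 ha h.mem_attrs.2
        · exact Set.disjoint_left.1 hE12 h hb
      · exact absurd (hPQ p hpP p (Set.union_subset h₁ h₂ (hUE ▸ .inl hpP))) (hself p)
    intro a b hab
    obtain ⟨d, hd', hab⟩ := precedes_par.1 hab
    rcases List.mem_cons.1 (hcs'.mem_iff.1 hd') with rfl | hd'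
    · exact h.precedes_le hleC hleC' hEs a b hab
    · exact hle a b (.inside (hcs.mem_iff.2 (by simp [hd'])) hab)
  | @inside op c c' l r h ih =>
    obtain ⟨-, hp, -⟩ := proper_node.1 hT
    have hcm : c ∈ l ++ c :: r := by simp
    have hcm' : c' ∈ l ++ c' :: r := by simp
    refine precedes_node_le h.attrs_eq hle (ih ((normalized_node.1 hn).2 c hcm) (hp c hcm)
      (fun a b hab => hle a b (.inside hcm hab)) (fun a ha b hb hab => ?_) ?_
      ((proper_node.1 hT').2.1 c' hcm'))
    · exact hT'.precedes_child hcm' (h.attrs_eq ▸ ha) (h.attrs_eq ▸ hb)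
        (hge a (attrs_subset_node hcm ha) b (attrs_subset_node hcm hb) hab)
    · obtain ⟨a, ha, b, hb, hab, habT⟩ := hnew
      have hab' : c'.Precedes a b := by
        have := hge a ha b hb hab
        simp only [precedes_append, precedes_cons, attrs_cons, h.attrs_eq] at this habT
        grind
      have hm := hab'.mem_attrs
      rw [h.attrs_eq] at hm
      exact ⟨a, hm.1, b, hm.2, hab, fun h => habT (.inside hcm h)⟩

end SyntaxTree

end PSkyline

theorem mainTheorem6 {A : Type*} [Finite A] {D : A → Type*} [∀ a, Infinite (D a)]
    (pref : ∀ a, D a → D a → Prop) [∀ a, IsStrictTotalOrder (D a) (pref a)]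
    (R : Set ((∀ a, D a) × (∀ a, D a))) (hR : R ∈ PSkyline.FullPSkyline pref)
    (T : PSkyline.SyntaxTree A) (hT : T.IsSyntaxTreeOf pref R) (hnorm : T.Normalized)
    (Rext : Set ((∀ a, D a) × (∀ a, D a))) :
    PSkyline.IsMinimalPExtension pref R Rext ↔
      ∃ T' : PSkyline.SyntaxTree A,
        PSkyline.SyntaxTree.RuleStep T T' ∧ T'.elim.IsSyntaxTreeOf pref Rext := by
  obtain ⟨π, hTπ, hπ, hπu, rfl⟩ := hT
  have hT2 := hTπ.proper hπ
  have hT1 := hT2.mono one_le_two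
  obtain ⟨hTv, hTp⟩ := hTπ.precedes_iff
  have hTu : ∀ a, a ∈ T.attrs := fun a => by
    rw [hTv, hπu]
    exact Set.mem_univ a
  -- The result of a rule application induces a proper extension.
  have hstep : ∀ T', PSkyline.SyntaxTree.RuleStep T T' → ∃ ρ : PSkyline.PExpr A,
      T'.elim.Represents ρ ∧ ρ.NonRepeating ∧ ρ.vars = Set.univ ∧
        (∀ a b, T'.Precedes a b ↔ ρ.Precedes a b) ∧ π.rel pref ⊂ ρ.rel pref := by
    intro T' h
    obtain ⟨ρ, hρ, hρn, hρv, hρp⟩ := (h.proper hT1).exists_elim_represents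
    have hρu : ρ.vars = Set.univ := by rw [← hρv, h.attrs_eq, hTv, hπu]
    refine ⟨ρ, hρ, hρn, hρu, hρp, ?_, ?_⟩
    · rw [PSkyline.PExpr.rel_subset_rel_iff pref hπ hρn hπu hρu]
      exact fun a b hab => (hρp a b).1 (h.precedes_mono ((hTp a b).2 hab))
    · rw [PSkyline.PExpr.rel_subset_rel_iff pref hρn hπ hρu hπu]
      intro hle
      obtain ⟨a, b, hab, hab'⟩ := h.exists_new hT1
      exact hab' ((hTp a b).2 (hle a b ((hρp a b).1 hab)))
  have hnew : ∀ σ : PSkyline.PExpr A, σ.NonRepeating → σ.vars = Set.univ →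
      π.rel pref ⊂ σ.rel pref → (∀ a b, T.Precedes a b → σ.Precedes a b) ∧
        ∃ a ∈ T.attrs, ∃ b ∈ T.attrs, σ.Precedes a b ∧ ¬ T.Precedes a b := by
    intro σ hσ hσu hlt
    refine ⟨fun a b hab => ?_, ?_⟩
    · exact (PSkyline.PExpr.rel_subset_rel_iff pref hπ hσ hπu hσu).1 hlt.1 a b ((hTp a b).1 hab)
    · have := hlt.2
      rw [PSkyline.PExpr.rel_subset_rel_iff pref hσ hπ hσu hπu] at this
      push Not at this
      obtain ⟨a, b, hab, hab'⟩ := this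
      exact ⟨a, hTu a, b, hTu b, hab, fun h => hab' ((hTp a b).1 h)⟩
  constructor
  · rintro ⟨⟨-, ⟨σ, hσ, hσu, rfl⟩, hlt⟩, hmin⟩
    obtain ⟨hle, hex⟩ := hnew σ hσ hσu hlt
    obtain ⟨T', h, hT'⟩ := PSkyline.SyntaxTree.exists_ruleStep hnorm hT2
      (PSkyline.PExpr.seriesParallel_precedes hσ hσu) hle hex
    obtain ⟨ρ, hρ, hρn, hρu, hρp, hlt'⟩ := hstep T' h
    have hρσ : ρ.rel pref ⊆ σ.rel pref := by
      rw [PSkyline.PExpr.rel_subset_rel_iff pref hρn hσ hρu hσu]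
      exact fun a b hab => hT' a b ((hρp a b).2 hab)
    refine ⟨T', h, ρ, hρ, hρn, hρu, hρσ.eq_of_not_ssubset fun hss => hmin ?_⟩
    exact ⟨_, ⟨ρ, hρn, hρu, rfl⟩, hlt', hss⟩
  · rintro ⟨T', h, ρ', hρ', -, -, rfl⟩
    obtain ⟨ρ, hρ, hρn, hρu, hρp, hlt⟩ := hstep T' h
    obtain rfl := hρ.unique hρ'
    refine ⟨⟨hR, ⟨ρ, hρn, hρu, rfl⟩, hlt⟩, ?_⟩
    rintro ⟨_, ⟨σ, hσ, hσu, rfl⟩, hlt₁, hlt₂⟩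
    obtain ⟨hle, hex⟩ := hnew σ hσ hσu hlt₁
    have hσρ := (PSkyline.PExpr.rel_subset_rel_iff pref hσ hρn hσu hρu).1 hlt₂.1
    refine hlt₂.2 ((PSkyline.PExpr.rel_subset_rel_iff pref hρn hσ hρu hσu).2 fun a b hab => ?_)
    exact h.precedes_le hnorm hT2 (PSkyline.PExpr.seriesParallel_precedes hσ hσu) hle
      (fun a _ b _ hab => (hρp a b).2 (hσρ a b hab)) hex a b ((hρp a b).2 hab)
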